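/- For each $n\ge 1$ let $X_{n1},\dots,X_{nn}$ be i.i.d. real random variables, let $h_n:\mathbb R\times\mathbb R\to\mathbb R$ be a symmetric Borel function with $\mathbb E[h_n(X_{ni},X_{nj})]=0$ and $\mathbb E[h_n(X_{ni},X_{nj})^2]<\infty$ for $1\le i\ne j\le n$, and let $Z_{ij}=Z_{ij}^{(n)}=Z_{ji}^{(n)}$, $1\le i\neq j\le n$, be Bernoulli($p_n$) random variables that are i.i.d. over the pairs $i<j$ and independent of $(X_{ni})_{i\le n}$. Assume that $np_n\to\infty$. Put $\Phi_n(i,j)=Z_{ij}h_n(X_{ni},X_{nj})$ and $$\mathcal U_n=\binom n2^{-1}\sum_{1\le i<j\le n}\Phi_n(i,j),\qquad \Psi_j(i)=\mathbb E[\Phi_n(i,j)\mid X_{ni},Z_{ij}],\qquad \tilde\Phi(i,j)=\Phi_n(i,j)-\Psi_j(i)-\Psi_i(j),$$ $$\beta_n^2=\mathbb E[\Phi_n(1,2)^2],\qquad \gamma_n^2=\mathbb E[\Psi_2(1)^2],\qquad \theta_n\ge 0,\quad \theta_n^2=np_n\gamma_n^2+\tfrac12\beta_n^2,$$ and, for $1\le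 i\le n$ (with $\xi_i:=0$ if $\theta_n=0$), $$\xi_i=\xi_{i,n}=\frac1{n\theta_n}\sum_{1\le j\le n,\ j\ne i}\Psi_j(i)+\frac1{n\theta_n}\sum_{j=1}^{i-1}\tilde\Phi(i,j).$$ Let $\mathcal F_{i-1}=\mathcal F_{i-1,n}$ be the $\sigma$-algebra generated by $X_{nk}$, $1\le k\le i-1$, and $Z_{lm}$, $1\le l\le i-1$, $1\le m\le n$, $m\ne l$. Assume that, as $n\to\infty$, (B1) for every $\varepsilon>0$, $\ \sum_{i=1}^n\mathbb E\big[\xi_i^2\,\mathbf 1_{\{|\xi_i|\ge\varepsilon\}}\mid\mathcal F_{i-1}\big]\to 0$ in probability; (B2) $\ \sum_{i=1}^n\mathbb E\big[\xi_i^2\mid\mathcal F_{i-1}\big]\to 1$ in probability. Then $\mathcal U_n/\sqrt{\operatorname{Var}\,\mathcal U_n}$ converges in distribution to a standard normal random variable as $n\to\infty$. (Condition (B2) forces $\operatorname{Var}\,\mathcal U_n>0$ for all large $n$; for the remaining $n$ the quotient may be read as $0$.) -/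

import Mathlib

open MeasureTheory ProbabilityTheory Filter Topology

noncomputable section

namespace DilutedUStat

variable {Ω : Type*} [mΩ : MeasurableSpace Ω]

/-! All definitions below concern one row, of length `n`, of the triangular array: a kernel `h`,
random variables `X i` for `1 ≤ i ≤ n`, edge variables `Z i j` for `1 ≤ i ≠ j ≤ n`, and the edge
probability `p`. Indices outside these ranges never matter. -/

/-- `Φ(i,j) = Z_{ij} h(X_i, X_j)`. -/
def Phi (h : ℝ → ℝ → ℝ) (X : ℕ → Ω → ℝ) (Z : ℕ → ℕ → Ω → ℝ) (i j : ℕ) : Ω → ℝ :=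
  fun ω => Z i j ω * h (X i ω) (X j ω)

/-- `Ψ_j(i) = E[Φ(i,j) | X_i, Z_{ij}]`. -/
def Psi (P : Measure Ω) (h : ℝ → ℝ → ℝ) (X : ℕ → Ω → ℝ) (Z : ℕ → ℕ → Ω → ℝ) (j i : ℕ) : Ω → ℝ :=
  P[Phi h X Z i j | MeasurableSpace.comap (X i) inferInstance ⊔
    MeasurableSpace.comap (Z i j) inferInstance]

/-- `Φ̃(i,j) = Φ(i,j) - Ψ_j(i) - Ψ_i(j)`. -/
def PhiTilde (P : Measure Ω) (h : ℝ → ℝ → ℝ) (X : ℕ → Ω → ℝ) (Z : ℕ → ℕ → Ω → ℝ) (i j : ℕ) :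
    Ω → ℝ :=
  fun ω => Phi h X Z i j ω - Psi P h X Z j i ω - Psi P h X Z i j ω

/-- `β² = E[Φ(1,2)²]`. -/
def betaSq (P : Measure Ω) (h : ℝ → ℝ → ℝ) (X : ℕ → Ω → ℝ) (Z : ℕ → ℕ → Ω → ℝ) : ℝ :=
  ∫ ω, Phi h X Z 1 2 ω ^ 2 ∂P

/-- `γ² = E[Ψ_2(1)²]`. -/
def gammaSq (P : Measure Ω) (h : ℝ → ℝ → ℝ) (X : ℕ → Ω → ℝ) (Z : ℕ → ℕ → Ω → ℝ) : ℝ :=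
  ∫ ω, Psi P h X Z 2 1 ω ^ 2 ∂P

/-- `θ`, the nonnegative root of `θ² = n p γ² + β² / 2`. -/
def theta (P : Measure Ω) (n : ℕ) (p : ℝ) (h : ℝ → ℝ → ℝ) (X : ℕ → Ω → ℝ)
    (Z : ℕ → ℕ → Ω → ℝ) : ℝ :=
  Real.sqrt (n * p * gammaSq P h X Z + betaSq P h X Z / 2)

/-- The incomplete U-statistic `(n choose 2)⁻¹ ∑_{1 ≤ i < j ≤ n} Φ(i,j)`. -/
def U (n : ℕ) (h : ℝ → ℝ → ℝ) (X : ℕ → Ω → ℝ) (Z : ℕ → ℕ → Ω → ℝ) : Ω → ℝ :=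
  fun ω => ((n.choose 2 : ℕ) : ℝ)⁻¹ *
    ∑ i ∈ Finset.Icc 1 n, ∑ j ∈ Finset.Ioc i n, Phi h X Z i j ω

/-- `ξ_i = (n θ)⁻¹ ∑_{j ≠ i} Ψ_j(i) + (n θ)⁻¹ ∑_{j < i} Φ̃(i,j)`. -/
def xi (P : Measure Ω) (n : ℕ) (p : ℝ) (h : ℝ → ℝ → ℝ) (X : ℕ → Ω → ℝ) (Z : ℕ → ℕ → Ω → ℝ)
    (i : ℕ) : Ω → ℝ :=
  fun ω =>
    1 / (n * theta P n p h X Z) * ∑ j ∈ (Finset.Icc 1 n).erase i, Psi P h X Z j i ω +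
    1 / (n * theta P n p h X Z) * ∑ j ∈ Finset.Ico 1 i, PhiTilde P h X Z i j ω

/-- The σ-algebra generated by `X_k`, `1 ≤ k ≤ i - 1`, and `Z_{lm}`, `1 ≤ l ≤ i - 1`,
`1 ≤ m ≤ n`, `m ≠ l`. -/
@[reducible] def past (n : ℕ) (X : ℕ → Ω → ℝ) (Z : ℕ → ℕ → Ω → ℝ) (i : ℕ) : MeasurableSpace Ω :=
  (⨆ k ∈ Finset.Ico 1 i, MeasurableSpace.comap (X k) inferInstance) ⊔
    ⨆ l ∈ Finset.Ico 1 i, ⨆ m ∈ (Finset.Icc 1 n).erase l,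
      MeasurableSpace.comap (Z l m) inferInstance

/-- `η₁ = ∑_i E[ξ_i² 1{|ξ_i| ≥ ε} | past of i]`. -/
def eta1 (P : Measure Ω) (n : ℕ) (p : ℝ) (h : ℝ → ℝ → ℝ) (X : ℕ → Ω → ℝ) (Z : ℕ → ℕ → Ω → ℝ)
    (ε : ℝ) : Ω → ℝ :=
  fun ω => ∑ i ∈ Finset.Icc 1 n,
    (P[{ω' | ε ≤ |xi P n p h X Z i ω'|}.indicator (fun ω' => xi P n p h X Z i ω' ^ 2) |
      past n X Z i]) ω

/-- `η₂ = ∑_i E[ξ_i² | past of i]`. -/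
def eta2 (P : Measure Ω) (n : ℕ) (p : ℝ) (h : ℝ → ℝ → ℝ) (X : ℕ → Ω → ℝ) (Z : ℕ → ℕ → Ω → ℝ) :
    Ω → ℝ :=
  fun ω => ∑ i ∈ Finset.Icc 1 n,
    (P[fun ω' => xi P n p h X Z i ω' ^ 2 | past n X Z i]) ω

end DilutedUStat

end

/-!
The proof rests on a central limit theorem for martingale difference arrays, which is proved here
from Lévy's continuity theorem, and on the Hoeffding decomposition of the kernel.

**Martingale central limit theorem**
(`tendstoInDistribution_sum_of_martingaleDifference`). Let `S` be the row sum of martingale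
differences `d_k` and `V` the sum of their conditional variances `v_k`. First stop the array before
`V` exceeds `2`: this is a predictable rule, and it changes nothing where `V` is close to `1`, which
happens with probability tending to one. For the stopped row, `E exp (itS + t²V/2)` is compared with
`1` by telescoping (`norm_integral_exp_sum_sub_one_le`). The point is that the factor
`exp (itS_k + t²V_{k+1}/2)` is determined by the past and bounded by `exp (t²)`, so that one step
costs only the Taylor remainders of `exp (i t d_k)` and `exp (-t² v_k / 2)`
(`norm_integral_exp_sub_exp_le`), whose sum is controlled by the Lindeberg quantity. As `V → 1`
boundedly in the stopped array, `E exp (itS) → exp (-t²/2)`.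

**The martingale structure.** With `g(x) = E h(x, X₁)`, one has `Ψ_j(i) = Z_{ij} g(X_i)` almost
surely (`IsRow.Psi_ae_eq`), and `Φ̃(i,j)` becomes `Z_{ij} (h(X_i, X_j) - g(X_i) - g(X_j))`. Both
`g` and the centred kernel integrate to zero in one variable, and `X_i` is independent of all
edges together with all `X_k`, `k ≠ i`. Integrating out `X_i` alone
(`IsRow.integral_mul_lin`, `IsRow.integral_mul_degen`) therefore gives all the orthogonality that is
needed: the formula for `Ψ`, the martingale difference property of the `ξ_i`
(`IsRow.condExp_xi`), and the vanishing of the mixed second moments.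

**Normalization.** Summing the decomposition over pairs yields
`U = (n choose 2)⁻¹ n θ ∑ ξ_i` whenever `θ ≠ 0` (`IsRow.U_eq_sum_xi`), and an exact second moment
computation gives `Var (∑ ξ_i) = (n - 1) / n * ((n - 2) p γ² + β² / 2) / (n p γ² + β² / 2)`, which
lies between `(1 - 1/n)(1 - 2/n)` and `1` (`IsRow.variance_sum_xi_mem_Icc`). Hence standardizing `U`
is asymptotically the same as taking `∑ ξ_i` itself, and Slutsky's theorem concludes. If `θ = 0`
then all `ξ_i` vanish, so the conditional variance condition excludes this for large `n`.
-/

noncomputable section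

namespace DilutedUStat

/-! ### Characteristic functions of martingale difference sums -/

lemma norm_exp_mul_I_sub_taylor_le (x : ℝ) :
    ‖Complex.exp (x * Complex.I) - (1 + x * Complex.I - x ^ 2 / 2)‖ ≤ 4 * x ^ 2 ∧
    ‖Complex.exp (x * Complex.I) - (1 + x * Complex.I - x ^ 2 / 2)‖ ≤ 4 * |x| ^ 3 := by
  rcases le_total |x| 1 with hx | hx
  · have h := Complex.norm_exp_sub_sum_le_norm_mul_exp (x * Complex.I) 3
    have h1 : ∑ m ∈ Finset.range 3, (x * Complex.I) ^ m / (m.factorial : ℂ) =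
        1 + x * Complex.I - x ^ 2 / 2 := by
      simp [Finset.sum_range_succ, mul_pow, Nat.factorial]
      ring
    have h2 : ‖(x : ℂ) * Complex.I‖ = |x| := by simp
    rw [h1, h2] at h
    have h3 : Real.exp |x| ≤ 4 := by
      have := Real.exp_le_exp.2 hx
      have := Real.exp_one_lt_d9
      linarith
    have h4 : |x| ^ 3 * Real.exp |x| ≤ 4 * |x| ^ 3 := by
      have := mul_le_mul_of_nonneg_left h3 (pow_nonneg (abs_nonneg x) 3)
      linarith
    refine ⟨h.trans (h4.trans ?_), h.trans h4⟩
    rw [← sq_abs x]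
    nlinarith [pow_nonneg (abs_nonneg x) 2]
  · have h : ‖Complex.exp (x * Complex.I) - (1 + x * Complex.I - x ^ 2 / 2)‖ ≤ 4 * x ^ 2 := by
      have h1 := norm_sub_le (1 + (x : ℂ) * Complex.I) (x ^ 2 / 2)
      have h2 := norm_add_le 1 ((x : ℂ) * Complex.I)
      calc _ ≤ ‖Complex.exp (x * Complex.I)‖ + (‖(1 : ℂ)‖ + ‖(x : ℂ) * Complex.I‖
              + ‖(x : ℂ) ^ 2 / 2‖) := (norm_sub_le _ _).trans (by linarith)
        _ = 2 + |x| + |x| ^ 2 / 2 := by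
            rw [Complex.norm_exp_ofReal_mul_I]; simp; ring
        _ ≤ 4 * x ^ 2 := by rw [← sq_abs x]; nlinarith
    refine ⟨h, h.trans ?_⟩
    rw [← sq_abs x]
    nlinarith [pow_nonneg (abs_nonneg x) 2]

lemma abs_exp_neg_sub_taylor_le {y : ℝ} (hy : 0 ≤ y) : |Real.exp (-y) - (1 - y)| ≤ y ^ 2 := by
  rcases le_total y 1 with h | h
  · have := Real.abs_exp_sub_one_sub_id_le (x := -y) (by rwa [abs_neg, abs_of_nonneg hy])
    rw [neg_sq] at this
    convert this using 2
    ring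
  · have h1 := Real.exp_pos (-y)
    have h2 : Real.exp (-y) ≤ 1 := Real.exp_le_one_iff.2 (by linarith)
    rw [abs_le]
    constructor <;> nlinarith

section Step

variable {Ω : Type*} {m mΩ : MeasurableSpace Ω} {P : Measure Ω}

/-- The part of `f²` on which `|f| ≥ ε`. -/
def tailSq (f : Ω → ℝ) (ε : ℝ) : Ω → ℝ := {ω | ε ≤ |f ω|}.indicator (fun ω => f ω ^ 2)

lemma tailSq_nonneg (f : Ω → ℝ) (ε : ℝ) (ω : Ω) : 0 ≤ tailSq f ε ω :=
  Set.indicator_nonneg (fun _ _ => sq_nonneg _) _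

lemma sq_le_add_tailSq (f : Ω → ℝ) {ε : ℝ} (hε : 0 < ε) (ω : Ω) :
    f ω ^ 2 ≤ ε ^ 2 + tailSq f ε ω := by
  by_cases h : ε ≤ |f ω|
  · rw [tailSq, Set.indicator_of_mem (by exact h)]
    nlinarith
  · rw [tailSq, Set.indicator_of_notMem (by exact h), ← sq_abs]
    have := abs_nonneg (f ω)
    nlinarith

lemma integrable_tailSq {f : Ω → ℝ} (hf : MemLp f 2 P) (ε : ℝ) : Integrable (tailSq f ε) P := by
  refine hf.integrable_sq.indicator₀ ?_
  exact nullMeasurableSet_le aemeasurable_const hf.aestronglyMeasurable.aemeasurable.abs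

variable [IsProbabilityMeasure P]

/-- A bounded `m`-measurable factor is orthogonal to a variable with zero conditional mean. -/
lemma integral_mul_eq_zero_of_condExp_eq_zero (hm : m ≤ mΩ) {A : Ω → ℂ}
    (hA : StronglyMeasurable[m] A) {C : ℝ} (hAC : ∀ ω, ‖A ω‖ ≤ C) {f : Ω → ℝ}
    (hf : Integrable f P) (hf0 : P[f | m] =ᵐ[P] 0) : ∫ ω, A ω * f ω ∂P = 0 := by
  have hint : Integrable (f • A) P := by
    refine (hf.norm.mul_const C).mono'
      (hf.aestronglyMeasurable.smul (hA.mono hm).aestronglyMeasurable) (ae_of_all _ fun ω => ?_)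
    simp only [Pi.smul_apply', norm_smul]
    gcongr
    exact hAC ω
  have h := condExp_smul_of_aestronglyMeasurable_right hf hint hA.aestronglyMeasurable
  have h2 : ∫ ω, A ω * f ω ∂P = ∫ ω, (f • A) ω ∂P := by
    congr 1 with ω
    simp [mul_comm]
  rw [h2, ← integral_condExp hm, integral_congr_ae h]
  refine integral_eq_zero_of_ae ?_
  filter_upwards [hf0] with ω hω
  simp [hω]

/-- The conditional variance `v` is at most `ε²` plus the conditional tail, so the Lindeberg
quantity controls its second moment. -/
lemma integral_sq_condVar_le (hm : m ≤ mΩ) {d v : Ω → ℝ} (hd : MemLp d 2 P)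
    (hv0 : ∀ ω, 0 ≤ v ω) (hv2 : ∀ ω, v ω ≤ 2)
    (hvd : v =ᵐ[P] P[fun ω => d ω ^ 2 | m]) {ε : ℝ} (hε : 0 < ε) :
    ∫ ω, v ω ^ 2 ∂P ≤ ε ^ 2 * ∫ ω, v ω ∂P + 2 * ∫ ω, tailSq d ε ω ∂P := by
  have hvint : Integrable v P := integrable_condExp.congr hvd.symm
  have hT := integrable_tailSq hd ε
  have h1 : v ≤ᵐ[P] fun ω => ε ^ 2 + (P[tailSq d ε | m]) ω := by
    have h2 : P[fun ω => d ω ^ 2 | m] ≤ᵐ[P] P[(fun _ => ε ^ 2) + tailSq d ε | m] :=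
      condExp_mono hd.integrable_sq ((integrable_const _).add hT)
        (ae_of_all _ fun ω => sq_le_add_tailSq d hε ω)
    have h3 := condExp_add (m := m) (integrable_const (μ := P) (ε ^ 2)) hT
    rw [condExp_const hm] at h3
    filter_upwards [hvd, h2, h3] with ω w1 w2 w3
    rw [w1]; rw [w3] at w2; exact w2
  have h4 : ∀ᵐ ω ∂P, 0 ≤ (P[tailSq d ε | m]) ω := condExp_nonneg (ae_of_all _ (tailSq_nonneg d ε))
  calc ∫ ω, v ω ^ 2 ∂P ≤ ∫ ω, (ε ^ 2 * v ω + 2 * (P[tailSq d ε | m]) ω) ∂P := by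
        refine integral_mono_of_nonneg (ae_of_all _ fun ω => sq_nonneg _)
          ((hvint.const_mul _).add (integrable_condExp.const_mul _)) ?_
        filter_upwards [h1, h4] with ω w1 w4
        have := hv0 ω
        have := hv2 ω
        nlinarith
    _ = _ := by
        rw [integral_add (hvint.const_mul _) (integrable_condExp.const_mul _),
          integral_const_mul, integral_const_mul, integral_condExp hm]

lemma norm_taylor_remainder_le (d : Ω → ℝ) (t : ℝ) {ε : ℝ} (ω : Ω) :
    ‖Complex.exp ((t * d ω : ℝ) * Complex.I) -
        (1 + (t * d ω : ℝ) * Complex.I - (t * d ω : ℝ) ^ 2 / 2)‖ ≤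
      4 * |t| ^ 3 * |ε| * d ω ^ 2 + 4 * t ^ 2 * tailSq d ε ω := by
  obtain ⟨h1, h2⟩ := norm_exp_mul_I_sub_taylor_le (t * d ω)
  by_cases h : ε ≤ |d ω|
  · rw [tailSq, Set.indicator_of_mem (by exact h)]
    refine h1.trans ?_
    have : 0 ≤ 4 * |t| ^ 3 * |ε| * d ω ^ 2 := by positivity
    linarith [mul_pow t (d ω) 2]
  · rw [tailSq, Set.indicator_of_notMem (by exact h)]
    refine h2.trans ?_
    rw [abs_mul, mul_pow, pow_succ |d ω|, sq_abs (d ω)]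
    have h3 : |d ω| ≤ |ε| := (not_le.1 h).le.trans (le_abs_self _)
    have h4 : 0 ≤ 4 * |t| ^ 3 * d ω ^ 2 := by positivity
    nlinarith

/-- One step of the telescoping argument: conditionally on `m`, the variable `exp (i t d)` may be
replaced by the Gaussian factor `exp (-t² v / 2)`, where `v` is the conditional variance of `d`. -/
lemma norm_integral_exp_sub_exp_le (hm : m ≤ mΩ) {A : Ω → ℂ} (hA : StronglyMeasurable[m] A)
    {C : ℝ} (hC : 0 ≤ C) (hAC : ∀ ω, ‖A ω‖ ≤ C) {d v : Ω → ℝ} (hd : MemLp d 2 P)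
    (hd0 : P[d | m] =ᵐ[P] 0)
    (hvm : StronglyMeasurable[m] v) (hv0 : ∀ ω, 0 ≤ v ω) (hv2 : ∀ ω, v ω ≤ 2)
    (hvd : v =ᵐ[P] P[fun ω => d ω ^ 2 | m]) {ε : ℝ} (hε : 0 < ε) (t : ℝ) :
    ‖∫ ω, A ω * (Complex.exp ((t * d ω : ℝ) * Complex.I) -
        (Real.exp (-(t ^ 2 * v ω / 2)) : ℝ)) ∂P‖ ≤
      C * ((4 * |t| ^ 3 * ε + t ^ 4 * ε ^ 2 / 4) * ∫ ω, v ω ∂P +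
        (4 * t ^ 2 + t ^ 4 / 2) * ∫ ω, tailSq d ε ω ∂P) := by
  have hvint : Integrable v P := integrable_condExp.congr hvd.symm
  have hT := integrable_tailSq hd ε
  have hd1 : Integrable d P := hd.integrable (by norm_num)
  have hd2 := hd.integrable_sq
  have hvsq : Integrable (fun ω => v ω ^ 2) P := by
    refine (hvint.const_mul 2).mono' ((hvm.mono hm).aestronglyMeasurable.pow 2)
      (ae_of_all _ fun ω => ?_)
    have := hv0 ω
    have := hv2 ω
    rw [Real.norm_of_nonneg (by positivity)]
    nlinarith
  have hAm := (hA.mono hm).aestronglyMeasurable (μ := P)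
  have bdd : ∀ f : Ω → ℝ, Integrable f P → Integrable (fun ω => A ω * f ω) P := fun f hf =>
    hf.ofReal.bdd_mul hAm (ae_of_all _ hAC)
  have hw : Integrable (fun ω => d ω ^ 2 - v ω) P := hd2.sub hvint
  have hwz : P[fun ω => d ω ^ 2 - v ω | m] =ᵐ[P] 0 := by
    have h1 := condExp_sub (m := m) hd2 hvint
    have h2 := condExp_of_stronglyMeasurable hm hvm hvint
    filter_upwards [h1, hvd] with ω w1 w2
    have w1' : (P[fun ω => d ω ^ 2 - v ω | m]) ω = (P[fun ω => d ω ^ 2 | m] - P[v | m]) ω := w1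
    rw [w1', Pi.sub_apply, h2, w2]; simp
  have z1 := integral_mul_eq_zero_of_condExp_eq_zero hm hA hAC hd1 hd0
  have z2 := integral_mul_eq_zero_of_condExp_eq_zero hm hA hAC hw hwz
  set r : Ω → ℂ := fun ω => Complex.exp ((t * d ω : ℝ) * Complex.I) -
    (1 + (t * d ω : ℝ) * Complex.I - (t * d ω : ℝ) ^ 2 / 2) with hr
  set q : Ω → ℝ := fun ω => Real.exp (-(t ^ 2 * v ω / 2)) - (1 - t ^ 2 * v ω / 2) with hq
  have hvm' := (hvm.mono hm).aestronglyMeasurable (μ := P)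
  have hrm : AEStronglyMeasurable r P := by
    have h1 : AEStronglyMeasurable (fun ω => ((t * d ω : ℝ) : ℂ)) P :=
      (hd1.const_mul t).ofReal.aestronglyMeasurable
    exact (Complex.continuous_exp.comp_aestronglyMeasurable (h1.mul_const _)).sub
      ((aestronglyMeasurable_const.add (h1.mul_const _)).sub ((h1.pow 2).mul_const _))
  have hqm : AEStronglyMeasurable q P := by
    exact (Real.continuous_exp.comp_aestronglyMeasurable
      (((hvm'.const_mul (t ^ 2)).mul_const (2⁻¹)).neg)).sub
      (aestronglyMeasurable_const.sub ((hvm'.const_mul (t ^ 2)).mul_const (2⁻¹)))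
  have hrb : ∀ ω, ‖r ω‖ ≤ 4 * |t| ^ 3 * ε * d ω ^ 2 + 4 * t ^ 2 * tailSq d ε ω := fun ω => by
    have := norm_taylor_remainder_le d t (ε := ε) ω
    rwa [abs_of_pos hε] at this
  have hqb : ∀ ω, ‖q ω‖ ≤ t ^ 4 / 4 * v ω ^ 2 := fun ω => by
    have := abs_exp_neg_sub_taylor_le (y := t ^ 2 * v ω / 2) (by have := hv0 ω; positivity)
    rw [Real.norm_eq_abs]
    refine this.trans (le_of_eq (by ring))
  have hib : Integrable (fun ω => 4 * |t| ^ 3 * ε * d ω ^ 2 + 4 * t ^ 2 * tailSq d ε ω) P :=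
    (hd2.const_mul _).add (hT.const_mul _)
  have hri : Integrable r P := hib.mono' hrm (ae_of_all _ hrb)
  have hqi : Integrable q P := (hvsq.const_mul _).mono' hqm (ae_of_all _ hqb)
  -- the linear and quadratic Taylor terms are conditionally centred; only remainders contribute
  have hid : ∀ ω, A ω * (Complex.exp ((t * d ω : ℝ) * Complex.I) -
        (Real.exp (-(t ^ 2 * v ω / 2)) : ℝ)) =
      A ω * (d ω : ℝ) * (t * Complex.I) - A ω * ((d ω ^ 2 - v ω : ℝ) : ℂ) * (t ^ 2 / 2) +
        A ω * (r ω - (q ω : ℝ)) := fun ω => by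
    simp only [hr, hq]
    push_cast
    ring
  have i3 : Integrable (fun ω => A ω * (r ω - (q ω : ℝ))) P :=
    (hri.sub hqi.ofReal).bdd_mul hAm (ae_of_all _ hAC)
  simp_rw [hid]
  have i12 : Integrable (fun ω => A ω * (d ω : ℝ) * (t * Complex.I) -
      A ω * ((d ω ^ 2 - v ω : ℝ) : ℂ) * (t ^ 2 / 2)) P :=
    ((bdd _ hd1).mul_const _).sub ((bdd _ hw).mul_const _)
  rw [integral_add i12 i3, integral_sub ((bdd _ hd1).mul_const _) ((bdd _ hw).mul_const _), integral_mul_const,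
    integral_mul_const, z1, z2, zero_mul, zero_mul, sub_zero, zero_add]
  have hvI : ∫ ω, v ω ∂P = ∫ ω, d ω ^ 2 ∂P := by
    rw [integral_congr_ae hvd, integral_condExp hm]
  calc ‖∫ ω, A ω * (r ω - (q ω : ℝ)) ∂P‖ ≤ ∫ ω, C * ((4 * |t| ^ 3 * ε * d ω ^ 2 +
          4 * t ^ 2 * tailSq d ε ω) + t ^ 4 / 4 * v ω ^ 2) ∂P := by
        refine norm_integral_le_of_norm_le ((hib.add (hvsq.const_mul _)).const_mul C)
          (ae_of_all _ fun ω => ?_)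
        rw [norm_mul]
        refine mul_le_mul (hAC ω) ((norm_sub_le _ _).trans (add_le_add (hrb ω) ?_))
          (norm_nonneg _) hC
        rw [Complex.norm_real]
        exact hqb ω
    _ = C * ((4 * |t| ^ 3 * ε * ∫ ω, v ω ∂P + 4 * t ^ 2 * ∫ ω, tailSq d ε ω ∂P) +
          t ^ 4 / 4 * ∫ ω, v ω ^ 2 ∂P) := by
        rw [integral_const_mul, integral_add hib (hvsq.const_mul _),
          integral_add (hd2.const_mul _) (hT.const_mul _), integral_const_mul,
          integral_const_mul, integral_const_mul, hvI]
    _ ≤ _ := by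
        have h := integral_sq_condVar_le hm hd hv0 hv2 hvd hε
        refine mul_le_mul_of_nonneg_left ?_ hC
        have ht : 0 ≤ t ^ 4 / 4 := by positivity
        nlinarith [mul_le_mul_of_nonneg_left h ht]

end Step

section Row

variable {Ω : Type*} {mΩ : MeasurableSpace Ω} {P : Measure Ω} [IsProbabilityMeasure P]

/-- The quantitative core of the martingale central limit theorem, for one row whose total
conditional variance `∑ v` is at most `2`: the variable `exp (i t S + t² V / 2)` has mean close
to `1`. -/
lemma norm_integral_exp_sum_sub_one_le (𝓕 : Filtration ℕ mΩ) (N : ℕ) {d v : ℕ → Ω → ℝ}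
    (hdm : ∀ k < N, StronglyMeasurable[𝓕 (k + 1)] (d k)) (hd : ∀ k < N, MemLp (d k) 2 P)
    (hd0 : ∀ k < N, P[d k | 𝓕 k] =ᵐ[P] 0)
    (hvm : ∀ k < N, StronglyMeasurable[𝓕 k] (v k)) (hv0 : ∀ k ω, 0 ≤ v k ω)
    (hv2 : ∀ ω, ∑ k ∈ Finset.range N, v k ω ≤ 2)
    (hvd : ∀ k < N, v k =ᵐ[P] P[fun ω => d k ω ^ 2 | 𝓕 k]) {ε : ℝ} (hε : 0 < ε) (t : ℝ) :
    ‖∫ ω, Complex.exp ((t * ∑ k ∈ Finset.range N, d k ω : ℝ) * Complex.I +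
        (t ^ 2 / 2 * ∑ k ∈ Finset.range N, v k ω : ℝ)) ∂P - 1‖ ≤
      Real.exp (t ^ 2) * (2 * (4 * |t| ^ 3 * ε + t ^ 4 * ε ^ 2 / 4) +
        (4 * t ^ 2 + t ^ 4 / 2) * ∑ k ∈ Finset.range N, ∫ ω, tailSq (d k) ε ω ∂P) := by
  set W : ℕ → Ω → ℂ := fun n ω => Complex.exp ((t * ∑ k ∈ Finset.range n, d k ω : ℝ) * Complex.I +
        (t ^ 2 / 2 * ∑ k ∈ Finset.range n, v k ω : ℝ)) with hW
  have hVle : ∀ n ≤ N, ∀ ω, ∑ k ∈ Finset.range n, v k ω ≤ 2 := fun n hn ω =>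
    (Finset.sum_le_sum_of_subset_of_nonneg (Finset.range_mono hn)
      (fun k _ _ => hv0 k ω)).trans (hv2 ω)
  have hSm : ∀ n ≤ N, StronglyMeasurable[𝓕 n] (fun ω => ∑ k ∈ Finset.range n, d k ω) :=
    fun n hn => Finset.stronglyMeasurable_fun_sum _ fun k hk => by
      have hk' := Finset.mem_range.1 hk
      exact (hdm k (by omega)).mono (𝓕.mono (by omega))
  have hVm : ∀ j n, n ≤ N → n ≤ j + 1 →
      StronglyMeasurable[𝓕 j] (fun ω => ∑ k ∈ Finset.range n, v k ω) :=
    fun j n hn hj => Finset.stronglyMeasurable_fun_sum _ fun k hk => by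
      have hk' := Finset.mem_range.1 hk
      exact (hvm k (by omega)).mono (𝓕.mono (by omega))
  have hexp : ∀ (j : ℕ) (f g : Ω → ℝ), StronglyMeasurable[𝓕 j] f → StronglyMeasurable[𝓕 j] g →
      StronglyMeasurable[𝓕 j] (fun ω => Complex.exp ((t * f ω : ℝ) * Complex.I +
        (t ^ 2 / 2 * g ω : ℝ))) := fun j f g hf hg => by
    exact Continuous.comp_stronglyMeasurable (g := fun z : ℝ × ℝ =>
      Complex.exp ((t * z.1 : ℝ) * Complex.I + (t ^ 2 / 2 * z.2 : ℝ))) (by fun_prop)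
      (hf.prodMk hg)
  have hnorm : ∀ x y : ℝ, y ≤ 2 →
      ‖Complex.exp ((t * x : ℝ) * Complex.I + (t ^ 2 / 2 * y : ℝ))‖ ≤ Real.exp (t ^ 2) := by
    intro x y hy
    rw [Complex.exp_add, norm_mul, Complex.norm_exp_ofReal_mul_I, one_mul, ← Complex.ofReal_exp,
      Complex.norm_real, Real.norm_of_nonneg (Real.exp_pos _).le, Real.exp_le_exp]
    nlinarith [sq_nonneg t]
  have hWint : ∀ n ≤ N, Integrable (W n) P := fun n hn =>
    (integrable_const (Real.exp (t ^ 2))).mono'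
      ((hexp n _ _ (hSm n hn) (hVm n n hn (by omega))).mono (𝓕.le n)).aestronglyMeasurable
      (ae_of_all _ fun ω => hnorm _ _ (hVle n hn ω))
  have hstep : ∀ n < N, ‖∫ ω, W (n + 1) ω ∂P - ∫ ω, W n ω ∂P‖ ≤
      Real.exp (t ^ 2) * ((4 * |t| ^ 3 * ε + t ^ 4 * ε ^ 2 / 4) * ∫ ω, v n ω ∂P +
        (4 * t ^ 2 + t ^ 4 / 2) * ∫ ω, tailSq (d n) ε ω ∂P) := by
    intro n hn
    have := norm_integral_exp_sub_exp_le (𝓕.le n)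
      (hexp n _ _ (hSm n hn.le) (hVm n (n + 1) hn le_rfl)) (Real.exp_pos (t ^ 2)).le
      (fun ω => hnorm _ _ (hVle (n + 1) hn ω)) (hd n hn) (hd0 n hn) (hvm n hn) (hv0 n)
      (fun ω => (Finset.single_le_sum (fun k _ => hv0 k ω)
        (Finset.mem_range.2 hn)).trans (hv2 ω)) (hvd n hn) hε t
    rw [← integral_sub (hWint _ hn) (hWint _ hn.le)]
    convert this using 5 with ω
    rw [mul_sub, Complex.ofReal_exp, ← Complex.exp_add, ← Complex.exp_add]
    simp only [hW, Finset.sum_range_succ]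
    congr 2 <;> push_cast <;> ring
  have hW0 : ∫ ω, W 0 ω ∂P = 1 := by simp [hW]
  have htel : ∫ ω, W N ω ∂P - 1 =
      ∑ n ∈ Finset.range N, (∫ ω, W (n + 1) ω ∂P - ∫ ω, W n ω ∂P) := by
    rw [Finset.sum_range_sub (fun n => ∫ ω, W n ω ∂P), hW0]
  change ‖∫ ω, W N ω ∂P - 1‖ ≤ _
  rw [htel]
  refine (norm_sum_le _ _).trans ((Finset.sum_le_sum fun n hn =>
    hstep n (Finset.mem_range.1 hn)).trans ?_)
  rw [← Finset.mul_sum, Finset.sum_add_distrib, ← Finset.mul_sum, ← Finset.mul_sum]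
  have hvint : ∀ k ∈ Finset.range N, Integrable (v k) P := fun k hk =>
    integrable_condExp.congr (hvd k (Finset.mem_range.1 hk)).symm
  have hsum : ∑ k ∈ Finset.range N, ∫ ω, v k ω ∂P ≤ 2 := by
    rw [← integral_finsetSum _ hvint]
    calc _ ≤ ∫ _, (2 : ℝ) ∂P := integral_mono (integrable_finsetSum _ hvint)
            (integrable_const _) hv2
      _ = 2 := by simp
  have hc : 0 ≤ 4 * |t| ^ 3 * ε + t ^ 4 * ε ^ 2 / 4 := by positivity
  refine mul_le_mul_of_nonneg_left ?_ (Real.exp_pos _).le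
  linarith [mul_le_mul_of_nonneg_left hsum hc]

end Row

/-! ### Stopping the array and passing to the limit -/

section Array

variable {Ω : Type*} {mΩ : MeasurableSpace Ω} {P : Measure Ω}

/-- A nonnegative version of the conditional variance of `d` given `m`. -/
def condSq (P : Measure Ω) (m : MeasurableSpace Ω) (d : Ω → ℝ) : Ω → ℝ :=
  fun ω => max ((P[fun ω => d ω ^ 2 | m]) ω) 0

lemma condSq_ae_eq (m : MeasurableSpace Ω) (d : Ω → ℝ) :
    condSq P m d =ᵐ[P] P[fun ω => d ω ^ 2 | m] := by
  have h : 0 ≤ᵐ[P] P[fun ω => d ω ^ 2 | m] := condExp_nonneg (ae_of_all _ fun ω => sq_nonneg _)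
  filter_upwards [h] with ω hω
  exact max_eq_left hω

/-- The predictable event that the conditional variance accumulated through step `k` is at
most `2`. -/
def keep (P : Measure Ω) (𝓕 : Filtration ℕ mΩ) (d : ℕ → Ω → ℝ) (k : ℕ) : Set Ω :=
  {ω | ∑ i ∈ Finset.range (k + 1), condSq P (𝓕 i) (d i) ω ≤ 2}

lemma stronglyMeasurable_condSq (m : MeasurableSpace Ω) (d : Ω → ℝ) :
    StronglyMeasurable[m] (condSq P m d) :=
  stronglyMeasurable_condExp.sup stronglyMeasurable_const

lemma measurableSet_keep (𝓕 : Filtration ℕ mΩ) (d : ℕ → Ω → ℝ) (k : ℕ) :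
    MeasurableSet[𝓕 k] (keep P 𝓕 d k) := by
  refine StronglyMeasurable.measurableSet_le (m := 𝓕 k) ?_ stronglyMeasurable_const
  exact Finset.stronglyMeasurable_fun_sum _ fun i hi =>
    (stronglyMeasurable_condSq _ _).mono (𝓕.mono (Nat.lt_succ_iff.1 (Finset.mem_range.1 hi)))

lemma sum_indicator_keep_le (𝓕 : Filtration ℕ mΩ) (d : ℕ → Ω → ℝ) (ω : Ω) (N : ℕ) :
    ∑ k ∈ Finset.range N, (keep P 𝓕 d k).indicator (condSq P (𝓕 k) (d k)) ω ≤ 2 := by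
  induction N with
  | zero => simp
  | succ N ih =>
    rw [Finset.sum_range_succ]
    by_cases h : ω ∈ keep P 𝓕 d N
    · refine le_trans ?_ (show ∑ i ∈ Finset.range (N + 1), condSq P (𝓕 i) (d i) ω ≤ 2 from h)
      rw [Finset.sum_range_succ, Set.indicator_of_mem h]
      gcongr with k hk
      exact Set.indicator_le_self' (fun _ _ => le_max_right _ _) _
    · rwa [Set.indicator_of_notMem h, add_zero]

lemma mem_keep_of_sum_le (𝓕 : Filtration ℕ mΩ) (d : ℕ → Ω → ℝ) {ω : Ω} {N : ℕ}
    (h : ∑ k ∈ Finset.range N, condSq P (𝓕 k) (d k) ω ≤ 2) {k : ℕ} (hk : k < N) :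
    ω ∈ keep P 𝓕 d k :=
  (Finset.sum_le_sum_of_subset_of_nonneg (Finset.range_mono hk)
    (fun _ _ _ => le_max_right _ _)).trans h

lemma tailSq_indicator (s : Set Ω) (d : Ω → ℝ) {ε : ℝ} (hε : 0 < ε) :
    tailSq (s.indicator d) ε = s.indicator (tailSq d ε) := by
  ext ω
  by_cases h : ω ∈ s
  · simp [tailSq, Set.indicator_apply, h]
  · simp [tailSq, h, hε.not_ge]

/-- Conditionally, the tail part of `d²` carries at most the whole conditional variance. -/
lemma condExp_tailSq_le {m : MeasurableSpace Ω} {d : Ω → ℝ} (hd : MemLp d 2 P) (ε : ℝ) :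
    ∀ᵐ ω ∂P, 0 ≤ (P[tailSq d ε | m]) ω ∧ (P[tailSq d ε | m]) ω ≤ condSq P m d ω := by
  have h1 : ∀ᵐ ω ∂P, 0 ≤ (P[tailSq d ε | m]) ω := condExp_nonneg (ae_of_all _ (tailSq_nonneg d ε))
  have h2 : P[tailSq d ε | m] ≤ᵐ[P] P[fun ω => d ω ^ 2 | m] :=
    condExp_mono (integrable_tailSq hd ε) hd.integrable_sq (ae_of_all _ fun ω =>
      Set.indicator_le_self' (fun _ _ => sq_nonneg _) _)
  filter_upwards [h1, h2, condSq_ae_eq m d] with ω w1 w2 w3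
  exact ⟨w1, w3 ▸ w2⟩

variable [IsProbabilityMeasure P]

/-- Uniformly bounded variables that are small wherever a sequence converging in probability is
close to its constant limit have vanishing mean norm. -/
lemma tendsto_integral_norm_of_tendstoInMeasure {E : Type*} [NormedAddCommGroup E]
    {f : ℕ → Ω → ℝ} {c : ℝ} (hf : ∀ n, AEMeasurable (f n) P)
    (hfc : TendstoInMeasure P f atTop (fun _ => c)) {g : ℕ → Ω → E} {C : ℝ}
    (hgC : ∀ n, ∀ᵐ ω ∂P, ‖g n ω‖ ≤ C)
    (hg : ∀ δ > 0, ∃ η > 0, ∀ n, ∀ᵐ ω ∂P, |f n ω - c| < η → ‖g n ω‖ ≤ δ) :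
    Tendsto (fun n => ∫ ω, ‖g n ω‖ ∂P) atTop (𝓝 0) := by
  have hC : 0 ≤ C := by
    obtain ⟨ω, hω⟩ := (hgC 0).exists
    exact (norm_nonneg _).trans hω
  rw [Metric.tendsto_atTop]
  intro δ hδ
  obtain ⟨η, hη, hgη⟩ := hg (δ / 2) (by positivity)
  have h1 := (tendstoInMeasure_iff_measureReal_norm.1 hfc) η hη
  have h2 : Tendsto (fun n => δ / 2 + C * P.real {ω | η ≤ ‖f n ω - c‖}) atTop (𝓝 (δ / 2)) := by
    simpa using (h1.const_mul C).const_add (δ / 2)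
  obtain ⟨N, hN⟩ := eventually_atTop.1 (h2.eventually_lt_const (by linarith : δ / 2 < δ))
  refine ⟨N, fun n hn => ?_⟩
  rw [Real.dist_eq, sub_zero, abs_of_nonneg (integral_nonneg fun ω => norm_nonneg _)]
  refine lt_of_le_of_lt ?_ (hN n hn)
  have hs : NullMeasurableSet {ω | η ≤ ‖f n ω - c‖} P :=
    nullMeasurableSet_le aemeasurable_const ((hf n).sub_const c).norm
  have hind : Integrable ({ω | η ≤ ‖f n ω - c‖}.indicator (fun _ => C)) P :=
    (integrable_const C).indicator₀ hs
  calc ∫ ω, ‖g n ω‖ ∂P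
      ≤ ∫ ω, (δ / 2 + {ω | η ≤ ‖f n ω - c‖}.indicator (fun _ => C) ω) ∂P := by
        refine integral_mono_of_nonneg (ae_of_all _ fun ω => norm_nonneg _)
          ((integrable_const _).add hind) ?_
        filter_upwards [hgC n, hgη n] with ω w1 w2
        by_cases h : η ≤ ‖f n ω - c‖
        · rw [Set.indicator_of_mem (by exact h)]
          linarith
        · rw [Set.indicator_of_notMem (by exact h), add_zero]
          exact w2 (not_le.1 h)
    _ = _ := by
        rw [integral_add (integrable_const _) hind, integral_indicator₀ hs]
        simp [mul_comm]

/-- **Martingale central limit theorem.** Row sums of a square integrable martingale difference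
array converge in distribution to a standard normal variable as soon as the conditional Lindeberg
condition holds and the conditional variances add up to `1` in the limit, in probability. -/
theorem tendstoInDistribution_sum_of_martingaleDifference (𝓕 : ℕ → Filtration ℕ mΩ) (N : ℕ → ℕ)
    {d : ℕ → ℕ → Ω → ℝ} (hdm : ∀ n, ∀ k < N n, StronglyMeasurable[𝓕 n (k + 1)] (d n k))
    (hd : ∀ n, ∀ k < N n, MemLp (d n k) 2 P) (hd0 : ∀ n, ∀ k < N n, P[d n k | 𝓕 n k] =ᵐ[P] 0)
    (hL : ∀ ε : ℝ, 0 < ε → TendstoInMeasure P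
      (fun n ω => ∑ k ∈ Finset.range (N n), (P[tailSq (d n k) ε | 𝓕 n k]) ω) atTop (fun _ => 0))
    (hV : TendstoInMeasure P
      (fun n ω => ∑ k ∈ Finset.range (N n), (P[fun ω => d n k ω ^ 2 | 𝓕 n k]) ω) atTop
      (fun _ => 1)) :
    TendstoInDistribution (fun n ω => ∑ k ∈ Finset.range (N n), d n k ω) atTop (id : ℝ → ℝ)
      (fun _ => P) (gaussianReal 0 1) := by
  have hSm : ∀ n, AEMeasurable (fun ω => ∑ k ∈ Finset.range (N n), d n k ω) P := fun n =>
    Finset.aemeasurable_fun_sum _ fun k hk =>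
      (hd n k (Finset.mem_range.1 hk)).aestronglyMeasurable.aemeasurable
  refine ⟨hSm, aemeasurable_id, ?_⟩
  refine ProbabilityMeasure.tendsto_iff_tendsto_charFun.2 fun t => ?_
  -- the array stopped before its conditional variance exceeds `2`
  set K : ℕ → ℕ → Set Ω := fun n k => keep P (𝓕 n) (d n) k with hK
  set d' : ℕ → ℕ → Ω → ℝ := fun n k => (K n k).indicator (d n k) with hd'
  set v' : ℕ → ℕ → Ω → ℝ := fun n k => (K n k).indicator (condSq P (𝓕 n k) (d n k)) with hv'
  have hKm : ∀ n k, MeasurableSet[𝓕 n k] (K n k) := fun n k => measurableSet_keep _ _ _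
  have hKm' : ∀ n k, MeasurableSet (K n k) := fun n k => (𝓕 n).le k _ (hKm n k)
  have hv'0 : ∀ n k ω, 0 ≤ v' n k ω := fun n k ω =>
    Set.indicator_nonneg (fun _ _ => le_max_right _ _) _
  have hv'2 : ∀ n ω, ∑ k ∈ Finset.range (N n), v' n k ω ≤ 2 := fun n ω =>
    sum_indicator_keep_le _ _ _ _
  have hVae : ∀ n, ∀ᵐ ω ∂P, ∀ k, condSq P (𝓕 n k) (d n k) ω = (P[fun ω => d n k ω ^ 2 | 𝓕 n k]) ω :=
    fun n => ae_all_iff.2 fun k => condSq_ae_eq _ _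
  have hd'm : ∀ n, ∀ k < N n, StronglyMeasurable[𝓕 n (k + 1)] (d' n k) := fun n k hk =>
    (hdm n k hk).indicator ((𝓕 n).mono (Nat.le_succ k) _ (hKm n k))
  have hv'm : ∀ n k, StronglyMeasurable[𝓕 n k] (v' n k) := fun n k =>
    (stronglyMeasurable_condSq _ _).indicator (hKm n k)
  have hd'L : ∀ n, ∀ k < N n, MemLp (d' n k) 2 P := fun n k hk => (hd n k hk).indicator (hKm' n k)
  have hd'0 : ∀ n, ∀ k < N n, P[d' n k | 𝓕 n k] =ᵐ[P] 0 := fun n k hk => by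
    filter_upwards [condExp_indicator ((hd n k hk).integrable (by norm_num)) (hKm n k),
      hd0 n k hk] with ω w1 w2
    rw [w1]
    by_cases h : ω ∈ K n k
    · rw [Set.indicator_of_mem h, w2]
    · rw [Set.indicator_of_notMem h]; rfl
  have hv'd : ∀ n, ∀ k < N n, v' n k =ᵐ[P] P[fun ω => d' n k ω ^ 2 | 𝓕 n k] := fun n k hk => by
    have h1 : (fun ω => d' n k ω ^ 2) = (K n k).indicator (fun ω => d n k ω ^ 2) := by
      ext ω
      by_cases h : ω ∈ K n k <;> simp [hd', h]
    rw [h1]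
    filter_upwards [condExp_indicator (hd n k hk).integrable_sq (hKm n k),
      condSq_ae_eq (P := P) (𝓕 n k) (d n k)] with ω w1 w2
    rw [w1]
    by_cases h : ω ∈ K n k <;> simp [hv', h, w2]
  -- the stopped array agrees with the given one where the total conditional variance is near `1`
  have hagree : ∀ n, ∀ᵐ ω ∂P,
      |∑ k ∈ Finset.range (N n), (P[fun ω => d n k ω ^ 2 | 𝓕 n k]) ω - 1| < 1 →
        ∑ k ∈ Finset.range (N n), v' n k ω =
          ∑ k ∈ Finset.range (N n), (P[fun ω => d n k ω ^ 2 | 𝓕 n k]) ω ∧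
        ∑ k ∈ Finset.range (N n), d' n k ω = ∑ k ∈ Finset.range (N n), d n k ω := fun n => by
    filter_upwards [hVae n] with ω w1 w2
    simp_rw [← w1] at w2 ⊢
    have h2 : ∀ k ∈ Finset.range (N n), ω ∈ K n k := fun k hk =>
      mem_keep_of_sum_le _ _ (by linarith [(abs_lt.1 w2).2]) (Finset.mem_range.1 hk)
    exact ⟨Finset.sum_congr rfl fun k hk => Set.indicator_of_mem (h2 k hk) _,
      Finset.sum_congr rfl fun k hk => Set.indicator_of_mem (h2 k hk) _⟩
  have hVm : ∀ n, AEMeasurable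
      (fun ω => ∑ k ∈ Finset.range (N n), (P[fun ω => d n k ω ^ 2 | 𝓕 n k]) ω) P := fun n =>
    Finset.aemeasurable_fun_sum _ fun k _ => integrable_condExp.aestronglyMeasurable.aemeasurable
  -- the stopped Lindeberg sums are bounded, hence vanish in mean
  have hΛ : ∀ ε : ℝ, 0 < ε → Tendsto
      (fun n => ∑ k ∈ Finset.range (N n), ∫ ω, tailSq (d' n k) ε ω ∂P) atTop (𝓝 0) := by
    intro ε hε
    have hae : ∀ n, ∀ᵐ ω ∂P, ∀ k, k < N n → 0 ≤ (P[tailSq (d n k) ε | 𝓕 n k]) ω ∧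
        (P[tailSq (d n k) ε | 𝓕 n k]) ω ≤ condSq P (𝓕 n k) (d n k) ω := fun n =>
      ae_all_iff.2 fun k => by
        by_cases hk : k < N n
        · filter_upwards [condExp_tailSq_le (m := 𝓕 n k) (hd n k hk) ε] with ω hω _ using hω
        · exact ae_of_all _ fun ω h => absurd h hk
    have hnn : ∀ n, ∀ᵐ ω ∂P, 0 ≤ ∑ k ∈ Finset.range (N n),
        (K n k).indicator (P[tailSq (d n k) ε | 𝓕 n k]) ω := fun n => by
      filter_upwards [hae n] with ω hω
      exact Finset.sum_nonneg fun k hk => by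
        by_cases h : ω ∈ K n k
        · rw [Set.indicator_of_mem h]; exact (hω k (Finset.mem_range.1 hk)).1
        · rw [Set.indicator_of_notMem h]
    have hlim := tendsto_integral_norm_of_tendstoInMeasure (P := P) (C := 2)
      (g := fun n ω => ∑ k ∈ Finset.range (N n),
        (K n k).indicator (P[tailSq (d n k) ε | 𝓕 n k]) ω)
      (fun n => Finset.aemeasurable_fun_sum _ fun k _ =>
        integrable_condExp.aestronglyMeasurable.aemeasurable) (hL ε hε)
      (fun n => by
        filter_upwards [hae n, hnn n] with ω hω h0
        rw [Real.norm_of_nonneg h0]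
        refine (Finset.sum_le_sum fun k hk => ?_).trans (hv'2 n ω)
        exact Set.indicator_le_indicator (hω k (Finset.mem_range.1 hk)).2)
      (fun δ hδ => ⟨δ, hδ, fun n => by
        filter_upwards [hae n, hnn n] with ω hω h0 hlt
        rw [Real.norm_of_nonneg h0]
        refine (Finset.sum_le_sum fun k hk => ?_).trans
          ((le_abs_self _).trans (by rw [sub_zero] at hlt; exact hlt.le))
        by_cases h : ω ∈ K n k
        · rw [Set.indicator_of_mem h]
        · rw [Set.indicator_of_notMem h]; exact (hω k (Finset.mem_range.1 hk)).1⟩)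
    refine hlim.congr fun n => ?_
    have h1 : ∀ k ∈ Finset.range (N n), Integrable
        ((K n k).indicator (P[tailSq (d n k) ε | 𝓕 n k])) P := fun k _ =>
      integrable_condExp.indicator (hKm' n k)
    rw [integral_congr_ae (g := fun ω => ∑ k ∈ Finset.range (N n),
        (K n k).indicator (P[tailSq (d n k) ε | 𝓕 n k]) ω)
        (by filter_upwards [hnn n] with ω h0 using Real.norm_of_nonneg h0),
      integral_finsetSum _ h1]
    refine Finset.sum_congr rfl fun k hk => ?_
    rw [hd', tailSq_indicator _ _ hε, ← integral_condExp (f := (K n k).indicator (tailSq (d n k) ε)) ((𝓕 n).le k)]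
    exact integral_congr_ae
      (condExp_indicator (integrable_tailSq (hd n k (Finset.mem_range.1 hk)) ε) (hKm n k)).symm
  set S : ℕ → Ω → ℝ := fun n ω => ∑ k ∈ Finset.range (N n), d n k ω with hS
  set S' : ℕ → Ω → ℝ := fun n ω => ∑ k ∈ Finset.range (N n), d' n k ω with hS'
  set V' : ℕ → Ω → ℝ := fun n ω => ∑ k ∈ Finset.range (N n), v' n k ω with hV'
  have hS'm : ∀ n, AEMeasurable (S' n) P := fun n => Finset.aemeasurable_fun_sum _ fun k hk =>
    (hd'L n k (Finset.mem_range.1 hk)).aestronglyMeasurable.aemeasurable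
  have hV'm : ∀ n, AEMeasurable (V' n) P := fun n => Finset.aemeasurable_fun_sum _ fun k hk =>
    ((hv'm n k).mono ((𝓕 n).le k)).measurable.aemeasurable
  have hV'0 : ∀ n ω, 0 ≤ V' n ω := fun n ω => Finset.sum_nonneg fun k _ => hv'0 n k ω
  have hlim1 : Tendsto (fun n => ∫ ω, Complex.exp ((t * S' n ω : ℝ) * Complex.I +
        (t ^ 2 / 2 * V' n ω : ℝ)) ∂P) atTop (𝓝 1) := by
    rw [Metric.tendsto_atTop]
    intro δ hδ
    have h1 : Tendsto (fun ε : ℝ => Real.exp (t ^ 2) *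
        (2 * (4 * |t| ^ 3 * ε + t ^ 4 * ε ^ 2 / 4))) (𝓝[>] 0) (𝓝 0) := by
      have : ContinuousAt (fun ε : ℝ => Real.exp (t ^ 2) *
        (2 * (4 * |t| ^ 3 * ε + t ^ 4 * ε ^ 2 / 4))) 0 := by fun_prop
      have h := this.tendsto
      simp only [mul_zero, ne_eq, OfNat.ofNat_ne_zero, not_false_eq_true, zero_pow, zero_div,
        add_zero] at h
      exact h.mono_left nhdsWithin_le_nhds
    obtain ⟨ε, h2, hε⟩ := ((h1.eventually_lt_const hδ).and self_mem_nhdsWithin).exists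
    have hε : 0 < ε := hε
    have h3 : Tendsto (fun n => Real.exp (t ^ 2) *
        (2 * (4 * |t| ^ 3 * ε + t ^ 4 * ε ^ 2 / 4) + (4 * t ^ 2 + t ^ 4 / 2) *
          ∑ k ∈ Finset.range (N n), ∫ ω, tailSq (d' n k) ε ω ∂P)) atTop
        (𝓝 (Real.exp (t ^ 2) * (2 * (4 * |t| ^ 3 * ε + t ^ 4 * ε ^ 2 / 4)))) := by
      simpa using (((hΛ ε hε).const_mul (4 * t ^ 2 + t ^ 4 / 2)).const_add
        (2 * (4 * |t| ^ 3 * ε + t ^ 4 * ε ^ 2 / 4))).const_mul (Real.exp (t ^ 2))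
    obtain ⟨M, hM⟩ := eventually_atTop.1 (h3.eventually_lt_const h2)
    refine ⟨M, fun n hn => lt_of_le_of_lt ?_ (hM n hn)⟩
    rw [dist_eq_norm]
    exact norm_integral_exp_sum_sub_one_le (𝓕 n) (N n) (hd'm n) (hd'L n) (hd'0 n)
      (fun k _ => hv'm n k) (hv'0 n) (hv'2 n) (hv'd n) hε t
  have hexp1 : ∀ x : ℝ, ‖Complex.exp ((t * x : ℝ) * Complex.I)‖ = 1 := fun x =>
    Complex.norm_exp_ofReal_mul_I _
  have hlim2 : Tendsto (fun n => ∫ ω, ‖Real.exp (t ^ 2 / 2 * V' n ω) - Real.exp (t ^ 2 / 2)‖ ∂P)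
      atTop (𝓝 0) := by
    refine tendsto_integral_norm_of_tendstoInMeasure (C := Real.exp (t ^ 2) + Real.exp (t ^ 2 / 2))
      hVm hV (fun n => ae_of_all _ fun ω => ?_) fun δ hδ => ?_
    · refine (norm_sub_le _ _).trans ?_
      rw [Real.norm_of_nonneg (Real.exp_pos _).le, Real.norm_of_nonneg (Real.exp_pos _).le]
      gcongr
      nlinarith [hv'2 n ω, sq_nonneg t]
    · have hc : ContinuousAt (fun x : ℝ => Real.exp (t ^ 2 / 2 * x)) 1 := by fun_prop
      obtain ⟨η, hη, h⟩ := Metric.continuousAt_iff.1 hc δ hδ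
      refine ⟨min η 1, lt_min hη one_pos, fun n => ?_⟩
      filter_upwards [hagree n] with ω w1 w2
      have h1 := h (x := V' n ω) (by
        rw [Real.dist_eq, hV']
        simp only
        rw [(w1 (w2.trans_le (min_le_right _ _))).1]
        exact w2.trans_le (min_le_left _ _))
      rw [dist_eq_norm, mul_one] at h1
      exact h1.le
  have hlim3 : Tendsto (fun n => ∫ ω, ‖Complex.exp ((t * S n ω : ℝ) * Complex.I) -
      Complex.exp ((t * S' n ω : ℝ) * Complex.I)‖ ∂P) atTop (𝓝 0) := by
    refine tendsto_integral_norm_of_tendstoInMeasure (C := 2)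
      hVm hV (fun n => ae_of_all _ fun ω => ?_) fun δ hδ => ⟨1, one_pos, fun n => ?_⟩
    · refine (norm_sub_le _ _).trans ?_
      rw [hexp1, hexp1]; norm_num
    · filter_upwards [hagree n] with ω w1 w2
      have : S' n ω = S n ω := (w1 w2).2
      rw [this, sub_self, norm_zero]
      exact hδ.le
  have hem : ∀ f : Ω → ℝ, AEMeasurable f P →
      AEStronglyMeasurable (fun ω => Complex.exp ((t * f ω : ℝ) * Complex.I)) P := fun f hf => by
    exact Continuous.comp_aestronglyMeasurable
      (g := fun z : ℝ => Complex.exp ((t * z : ℝ) * Complex.I)) (by fun_prop)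
      hf.aestronglyMeasurable
  have hei : ∀ f : Ω → ℝ, AEMeasurable f P →
      Integrable (fun ω => Complex.exp ((t * f ω : ℝ) * Complex.I)) P := fun f hf =>
    (integrable_const (1 : ℝ)).mono' (hem f hf) (ae_of_all _ fun ω => (hexp1 _).le)
  have hri : ∀ n, Integrable (fun ω => Real.exp (t ^ 2 / 2 * V' n ω)) P := fun n =>
    (integrable_const (Real.exp (t ^ 2))).mono'
      (Real.measurable_exp.comp_aemeasurable ((hV'm n).const_mul _)).aestronglyMeasurable
      (ae_of_all _ fun ω => by
        rw [Real.norm_of_nonneg (Real.exp_pos _).le]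
        gcongr
        nlinarith [hv'2 n ω, sq_nonneg t])
  have hlim4 : Tendsto (fun n => ∫ ω, Complex.exp ((t * S n ω : ℝ) * Complex.I) ∂P) atTop
      (𝓝 ((Real.exp (t ^ 2 / 2))⁻¹ : ℝ)) := by
    have hz3 : Tendsto (fun n => ∫ ω, (Complex.exp ((t * S n ω : ℝ) * Complex.I) -
        Complex.exp ((t * S' n ω : ℝ) * Complex.I)) ∂P) atTop (𝓝 0) :=
      squeeze_zero_norm (fun n => norm_integral_le_integral_norm _) hlim3
    have hz2 : Tendsto (fun n => ∫ ω, Complex.exp ((t * S' n ω : ℝ) * Complex.I) *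
        ((Real.exp (t ^ 2 / 2 * V' n ω) - Real.exp (t ^ 2 / 2) : ℝ) : ℂ) ∂P) atTop (𝓝 0) := by
      refine squeeze_zero_norm (fun n => (norm_integral_le_integral_norm _).trans (le_of_eq ?_))
        hlim2
      congr 1 with ω
      rw [norm_mul, hexp1, one_mul, Complex.norm_real]
    have hcomb := ((hlim1.sub hz2).mul_const (((Real.exp (t ^ 2 / 2))⁻¹ : ℝ) : ℂ)).add hz3
    simp only [sub_zero, one_mul, add_zero] at hcomb
    refine hcomb.congr fun n => ?_
    have hi : Integrable (fun ω => Complex.exp ((t * S' n ω : ℝ) * Complex.I) *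
        ((Real.exp (t ^ 2 / 2 * V' n ω) - Real.exp (t ^ 2 / 2) : ℝ) : ℂ)) P :=
      (((hri n).sub (integrable_const _)).ofReal).bdd_mul (hem _ (hS'm n))
        (ae_of_all _ fun ω => (hexp1 _).le)
    have hi' : Integrable (fun ω => Complex.exp ((t * S' n ω : ℝ) * Complex.I +
        (t ^ 2 / 2 * V' n ω : ℝ))) P := by
      refine ((hri n).ofReal.bdd_mul (hem _ (hS'm n))
        (ae_of_all _ fun ω => (hexp1 _).le)).congr (ae_of_all _ fun ω => ?_)
      simp only
      rw [Complex.exp_add]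
      congr 1
      exact Complex.ofReal_exp _
    rw [integral_sub (hei _ (hSm n)) (hei _ (hS'm n)), ← integral_sub hi' hi,
      ← integral_mul_const]
    have : ∀ ω, (Complex.exp ((t * S' n ω : ℝ) * Complex.I + (t ^ 2 / 2 * V' n ω : ℝ)) -
        Complex.exp ((t * S' n ω : ℝ) * Complex.I) *
        ((Real.exp (t ^ 2 / 2 * V' n ω) - Real.exp (t ^ 2 / 2) : ℝ) : ℂ)) *
        (((Real.exp (t ^ 2 / 2))⁻¹ : ℝ) : ℂ) = Complex.exp ((t * S' n ω : ℝ) * Complex.I) :=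
      fun ω => by
        have hne : ((Real.exp (t ^ 2 / 2) : ℝ) : ℂ) ≠ 0 :=
          Complex.ofReal_ne_zero.2 (Real.exp_pos _).ne'
        rw [Complex.exp_add, ← Complex.ofReal_exp, Complex.ofReal_sub, Complex.ofReal_inv]
        field_simp
        ring
    simp_rw [this]
    ring
  have hG : charFun (gaussianReal 0 1) t = ((Real.exp (t ^ 2 / 2))⁻¹ : ℝ) := by
    rw [charFun_gaussianReal, ← Real.exp_neg, Complex.ofReal_exp]
    simp
  simp only [ProbabilityMeasure.coe_mk, Measure.map_id]
  rw [hG]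
  refine hlim4.congr fun n => ?_
  rw [charFun_apply_real, integral_map (hSm n) (by fun_prop)]
  simp [hS]

end Array

/-! ### Independence and integration of one coordinate -/

section Independence

variable {Ω : Type*} {mΩ : MeasurableSpace Ω} {P : Measure Ω}

lemma indepFun_of_measurable {β γ : Type*} {mβ : MeasurableSpace β} {mγ : MeasurableSpace γ}
    {m₁ m₂ : MeasurableSpace Ω} (hm : Indep m₁ m₂ P) {f : Ω → β} {g : Ω → γ}
    (hf : Measurable[m₁] f) (hg : Measurable[m₂] g) : IndepFun f g P :=
  (IndepFun_iff_Indep _ _ _).2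
    (indep_of_indep_of_le_left (indep_of_indep_of_le_right hm hg.comap_le) hf.comap_le)

variable [IsProbabilityMeasure P]

lemma indepFun_prodMk_right_of_prodMk_left {α β γ : Type*} {mα : MeasurableSpace α}
    {mβ : MeasurableSpace β} {mγ : MeasurableSpace γ} {A : Ω → α} {B : Ω → β} {C : Ω → γ}
    (hA : Measurable A) (hB : Measurable B) (hC : Measurable C) (hAB : IndepFun A B P)
    (hABC : IndepFun (fun ω => (A ω, B ω)) C P) : IndepFun A (fun ω => (B ω, C ω)) P := by
  have hBC : IndepFun B C P := hABC.comp measurable_snd measurable_id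
  rw [indepFun_iff_map_prod_eq_prod_map_map hA.aemeasurable (hB.prodMk hC).aemeasurable]
  rw [indepFun_iff_map_prod_eq_prod_map_map hA.aemeasurable hB.aemeasurable] at hAB
  rw [indepFun_iff_map_prod_eq_prod_map_map hB.aemeasurable hC.aemeasurable] at hBC
  rw [indepFun_iff_map_prod_eq_prod_map_map (hA.prodMk hB).aemeasurable hC.aemeasurable] at hABC
  have := Measure.isProbabilityMeasure_map (μ := P) hA.aemeasurable
  have := Measure.isProbabilityMeasure_map (μ := P) hB.aemeasurable
  have := Measure.isProbabilityMeasure_map (μ := P) hC.aemeasurable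
  rw [hBC, ← Measure.prodAssoc_prod, ← hAB, ← hABC,
    Measure.map_map MeasurableEquiv.prodAssoc.measurable ((hA.prodMk hB).prodMk hC)]
  rfl

/-- In an independent family that is jointly independent of `g`, each member is independent of all
the others together with `g`. -/
lemma indepFun_others {ι γ : Type*} [Fintype ι] [DecidableEq ι] {mγ : MeasurableSpace γ}
    {f : ι → Ω → ℝ} {g : Ω → γ} (hf : ∀ i, Measurable (f i)) (hg : Measurable g)
    (hfi : iIndepFun f P) (hfg : IndepFun (fun ω i => f i ω) g P) (i : ι) :
    IndepFun (f i) (fun ω => ((fun k : {k // k ≠ i} => f k ω), g ω)) P := by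
  refine indepFun_prodMk_right_of_prodMk_left (hf i)
    (measurable_pi_lambda _ fun k => hf k) hg ?_ ?_
  · have h := hfi.indepFun_finset {i} (Finset.univ.erase i) (by simp) hf
    exact h.comp (φ := fun x : ↥({i} : Finset ι) → ℝ => x ⟨i, by simp⟩)
      (ψ := fun (x : ↥(Finset.univ.erase i) → ℝ) (k : {k // k ≠ i}) =>
        x ⟨k, by simp [k.2]⟩) (by fun_prop) (by fun_prop)
  · exact hfg.comp (φ := fun x => (x i, fun k : {k // k ≠ i} => x k)) (by fun_prop) measurable_id

/-- Integrating out `Y`: if the kernel `k` integrates to zero in the variable of `Y`, then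
`k (Y, V)` is orthogonal to whatever is, jointly with `V`, independent of `Y`. -/
lemma integral_mul_kernel_eq_zero {Y B V : Ω → ℝ} (hY : Measurable Y) (hB : Measurable B)
    (hV : Measurable V) (hind : IndepFun Y (fun ω => (B ω, V ω)) P) {k : ℝ → ℝ → ℝ}
    (hk : Measurable (Function.uncurry k)) (hk0 : ∀ᵐ v ∂(P.map V), ∫ x, k x v ∂(P.map Y) = 0)
    (hint : Integrable (fun ω => B ω * k (Y ω) (V ω)) P) : ∫ ω, B ω * k (Y ω) (V ω) ∂P = 0 := by
  have hBV := hB.prodMk hV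
  have hYm := Measure.isProbabilityMeasure_map (μ := P) hY.aemeasurable
  have hBm := Measure.isProbabilityMeasure_map (μ := P) hBV.aemeasurable
  rw [indepFun_iff_map_prod_eq_prod_map_map hY.aemeasurable hBV.aemeasurable] at hind
  have hF : Measurable (fun z : ℝ × (ℝ × ℝ) => z.2.1 * k z.1 z.2.2) :=
    (by fun_prop : Measurable fun z : ℝ × (ℝ × ℝ) => z.2.1).mul
      (hk.comp (by fun_prop : Measurable fun z : ℝ × (ℝ × ℝ) => (z.1, z.2.2)))
  have hint' : Integrable (fun z : ℝ × (ℝ × ℝ) => z.2.1 * k z.1 z.2.2)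
      ((P.map Y).prod (P.map fun ω => (B ω, V ω))) := by
    rw [← hind]
    exact (integrable_map_measure hF.aestronglyMeasurable (hY.prodMk hBV).aemeasurable).2 hint
  have h1 : ∫ ω, B ω * k (Y ω) (V ω) ∂P = ∫ z : ℝ × (ℝ × ℝ), z.2.1 * k z.1 z.2.2
      ∂((P.map Y).prod (P.map fun ω => (B ω, V ω))) := by
    rw [← hind, integral_map (hY.prodMk hBV).aemeasurable hF.aestronglyMeasurable]
  rw [h1, integral_prod_symm _ hint']
  refine integral_eq_zero_of_ae ?_
  have h2 : P.map V = (P.map fun ω => (B ω, V ω)).map Prod.snd := by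
    rw [Measure.map_map measurable_snd hBV]; rfl
  rw [h2] at hk0
  filter_upwards [ae_of_ae_map measurable_snd.aemeasurable hk0] with z hz
  simp only [Pi.zero_apply]
  rw [integral_const_mul, hz, mul_zero]

end Independence

/-! ### One row of the triangular array -/

/-- The standing assumptions on one row of the triangular array. -/
structure IsRow {Ω : Type*} [MeasurableSpace Ω] (P : Measure Ω) (n : ℕ) (p : unitInterval)
    (h : ℝ → ℝ → ℝ) (X : ℕ → Ω → ℝ) (Z : ℕ → ℕ → Ω → ℝ) : Prop where
  X_meas : ∀ i ∈ Finset.Icc 1 n, Measurable (X i)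
  X_indep : iIndepFun (fun i : Finset.Icc 1 n => X i) P
  X_ident : ∀ i ∈ Finset.Icc 1 n, ∀ j ∈ Finset.Icc 1 n, IdentDistrib (X i) (X j) P P
  h_meas : Measurable (Function.uncurry h)
  h_symm : ∀ x y, h x y = h y x
  Z_meas : ∀ i ∈ Finset.Icc 1 n, ∀ j ∈ Finset.Icc 1 n, i ≠ j → Measurable (Z i j)
  Z_symm : ∀ i ∈ Finset.Icc 1 n, ∀ j ∈ Finset.Icc 1 n, i ≠ j → Z i j = Z j i
  Z_law : ∀ i ∈ Finset.Icc 1 n, ∀ j ∈ Finset.Icc 1 n, i ≠ j →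
    HasLaw (Z i j) (bernoulliMeasure (1 : ℝ) 0 p) P
  Z_indep : iIndepFun
    (fun q : {q : ℕ × ℕ // 1 ≤ q.1 ∧ q.1 < q.2 ∧ q.2 ≤ n} => Z q.1.1 q.1.2) P
  XZ_indep : IndepFun
    (fun ω (i : Finset.Icc 1 n) => X i ω)
    (fun ω (q : {q : ℕ × ℕ // 1 ≤ q.1 ∧ q.1 < q.2 ∧ q.2 ≤ n}) => Z q.1.1 q.1.2 ω) P
  h_mean : ∀ i ∈ Finset.Icc 1 n, ∀ j ∈ Finset.Icc 1 n, i ≠ j → ∫ ω, h (X i ω) (X j ω) ∂P = 0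
  h_sq : ∀ i ∈ Finset.Icc 1 n, ∀ j ∈ Finset.Icc 1 n, i ≠ j →
    Integrable (fun ω => h (X i ω) (X j ω) ^ 2) P

section Row

variable {Ω : Type*} {mΩ : MeasurableSpace Ω}

/-- The Hájek projection `g(x) = E[h(x, X₁)]` of the kernel. -/
def proj (P : Measure Ω) (h : ℝ → ℝ → ℝ) (X : ℕ → Ω → ℝ) (x : ℝ) : ℝ := ∫ y, h x y ∂(P.map (X 1))

/-- The linear term `Z_{ij} g(X_i)`, a version of `Ψ_j(i)`. -/
def lin (P : Measure Ω) (h : ℝ → ℝ → ℝ) (X : ℕ → Ω → ℝ) (Z : ℕ → ℕ → Ω → ℝ) (i j : ℕ) : Ω → ℝ :=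
  fun ω => Z i j ω * proj P h X (X i ω)

/-- The degenerate term `Z_{ij} (h(X_i, X_j) - g(X_i) - g(X_j))`, a version of `Φ̃(i,j)`. -/
def degen (P : Measure Ω) (h : ℝ → ℝ → ℝ) (X : ℕ → Ω → ℝ) (Z : ℕ → ℕ → Ω → ℝ) (i j : ℕ) : Ω → ℝ :=
  fun ω => Z i j ω * (h (X i ω) (X j ω) - proj P h X (X i ω) - proj P h X (X j ω))

/-- The σ-algebra generated by all edge variables and by all `X_k`, `1 ≤ k ≤ n`, except `X_i`. -/
@[reducible] def others (n : ℕ) (X : ℕ → Ω → ℝ) (Z : ℕ → ℕ → Ω → ℝ) (i : Finset.Icc 1 n) :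
    MeasurableSpace Ω :=
  MeasurableSpace.comap (fun ω => ((fun k : {k : Finset.Icc 1 n // k ≠ i} => X k ω),
    fun q : {q : ℕ × ℕ // 1 ≤ q.1 ∧ q.1 < q.2 ∧ q.2 ≤ n} => Z q.1.1 q.1.2 ω)) inferInstance

variable {P : Measure Ω} {n : ℕ} {p : unitInterval} {h : ℝ → ℝ → ℝ}
  {X : ℕ → Ω → ℝ} {Z : ℕ → ℕ → Ω → ℝ}

namespace IsRow

lemma measurable_edges (H : IsRow P n p h X Z) : Measurable
    (fun ω (q : {q : ℕ × ℕ // 1 ≤ q.1 ∧ q.1 < q.2 ∧ q.2 ≤ n}) => Z q.1.1 q.1.2 ω) :=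
  measurable_pi_lambda _ fun q => H.Z_meas _ (by simp; omega) _ (by simp; omega) (by omega)

/-- Every edge variable is a coordinate of the family indexed by pairs `l < m`. -/
lemma exists_edge (H : IsRow P n p h X Z) {l m : ℕ} (hl : l ∈ Finset.Icc 1 n)
    (hm : m ∈ Finset.Icc 1 n) (hlm : l ≠ m) :
    ∃ q : {q : ℕ × ℕ // 1 ≤ q.1 ∧ q.1 < q.2 ∧ q.2 ≤ n}, Z l m = Z q.1.1 q.1.2 ∧
      q.1 = (min l m, max l m) := by
  rw [Finset.mem_Icc] at hl hm
  rcases lt_or_gt_of_ne hlm with hlt | hlt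
  · exact ⟨⟨(l, m), by simp; omega⟩, rfl, by simp [hlt.le]⟩
  · exact ⟨⟨(m, l), by simp; omega⟩, H.Z_symm _ (by simpa using hl) _ (by simpa using hm) hlm,
      by simp [hlt.le]⟩

lemma measurable_others_Z (H : IsRow P n p h X Z) (i : Finset.Icc 1 n) {l m : ℕ}
    (hl : l ∈ Finset.Icc 1 n) (hm : m ∈ Finset.Icc 1 n) (hlm : l ≠ m) :
    Measurable[others n X Z i] (Z l m) := by
  obtain ⟨q, hq, -⟩ := H.exists_edge hl hm hlm
  rw [hq]
  let F : ({k : Finset.Icc 1 n // k ≠ i} → ℝ) ×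
      ({q : ℕ × ℕ // 1 ≤ q.1 ∧ q.1 < q.2 ∧ q.2 ≤ n} → ℝ) → ℝ := fun z => z.2 q
  have hF : Measurable F := by fun_prop
  exact hF.comp (comap_measurable _)

lemma measurable_others_X {i : Finset.Icc 1 n} {k : ℕ}
    (hk : k ∈ Finset.Icc 1 n) (hki : k ≠ i) : Measurable[others n X Z i] (X k) := by
  let F : ({k : Finset.Icc 1 n // k ≠ i} → ℝ) ×
      ({q : ℕ × ℕ // 1 ≤ q.1 ∧ q.1 < q.2 ∧ q.2 ≤ n} → ℝ) → ℝ :=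
    fun z => z.1 ⟨⟨k, hk⟩, fun h => hki (congrArg Subtype.val h)⟩
  have hF : Measurable F := by fun_prop
  exact hF.comp (comap_measurable _)

lemma others_le (H : IsRow P n p h X Z) (i : Finset.Icc 1 n) : others n X Z i ≤ mΩ :=
  ((measurable_pi_lambda _ fun k => H.X_meas _ k.1.2).prodMk H.measurable_edges).comap_le

lemma map_X (H : IsRow P n p h X Z) {i : ℕ} (hi : i ∈ Finset.Icc 1 n) :
    P.map (X i) = P.map (X 1) := by
  rw [Finset.mem_Icc] at hi
  exact (H.X_ident i (by simpa using hi) 1 (by simp; omega)).map_eq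

lemma integral_Z (H : IsRow P n p h X Z) {i j : ℕ} (hi : i ∈ Finset.Icc 1 n)
    (hj : j ∈ Finset.Icc 1 n) (hij : i ≠ j) : ∫ ω, Z i j ω ∂P = p := by
  have hl := (H.Z_law i hi j hj hij).map_eq
  have h1 := integral_map (μ := P) (H.Z_meas i hi j hj hij).aemeasurable
    (f := fun x : ℝ => x) (by fun_prop)
  rw [← h1, hl, integral_bernoulliMeasure]
  simp

lemma memLp_h (H : IsRow P n p h X Z) {i j : ℕ} (hi : i ∈ Finset.Icc 1 n)
    (hj : j ∈ Finset.Icc 1 n) (hij : i ≠ j) : MemLp (fun ω => h (X i ω) (X j ω)) 2 P :=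
  (memLp_two_iff_integrable_sq (H.h_meas.comp
    ((H.X_meas i hi).prodMk (H.X_meas j hj))).aestronglyMeasurable).2 (H.h_sq i hi j hj hij)

lemma degen_symm (H : IsRow P n p h X Z) {i j : ℕ} (hi : i ∈ Finset.Icc 1 n)
    (hj : j ∈ Finset.Icc 1 n) (hij : i ≠ j) : degen P h X Z i j = degen P h X Z j i := by
  ext ω
  simp only [degen]
  rw [H.Z_symm i hi j hj hij, H.h_symm]
  ring

lemma Z_mem (H : IsRow P n p h X Z) {i j : ℕ} (hi : i ∈ Finset.Icc 1 n)
    (hj : j ∈ Finset.Icc 1 n) (hij : i ≠ j) : ∀ᵐ ω ∂P, Z i j ω = 1 ∨ Z i j ω = 0 := by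
  have hl := (H.Z_law i hi j hj hij).map_eq
  refine ae_of_ae_map (H.Z_meas i hi j hj hij).aemeasurable (p := fun x => x = 1 ∨ x = 0) ?_
  rw [hl, ae_iff]
  have hs : MeasurableSet {x : ℝ | ¬ (x = 1 ∨ x = 0)} :=
    ((measurableSet_singleton (1 : ℝ)).union (measurableSet_singleton (0 : ℝ))).compl
  exact bernoulliMeasure_apply_of_notMem_of_notMem _ hs (by simp) (by simp)

lemma memLp_Z_mul (H : IsRow P n p h X Z) {i j : ℕ} (hi : i ∈ Finset.Icc 1 n)
    (hj : j ∈ Finset.Icc 1 n) (hij : i ≠ j) {f : Ω → ℝ} (hf : MemLp f 2 P) :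
    MemLp (fun ω => Z i j ω * f ω) 2 P := by
  refine hf.of_le ((H.Z_meas i hi j hj hij).aestronglyMeasurable.mul hf.aestronglyMeasurable) ?_
  filter_upwards [H.Z_mem hi hj hij] with ω hω
  rcases hω with hω | hω <;> simp [hω]

lemma integral_Z_mul_Z (H : IsRow P n p h X Z) {i j k : ℕ} (hi : i ∈ Finset.Icc 1 n)
    (hj : j ∈ Finset.Icc 1 n) (hij : i ≠ j) (hk : k ∈ Finset.Icc 1 n) (hik : i ≠ k) :
    ∫ ω, Z i j ω * Z i k ω ∂P = if j = k then (p : ℝ) else (p : ℝ) ^ 2 := by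
  split_ifs with hjk
  · subst hjk
    rw [← H.integral_Z hi hj hij]
    refine integral_congr_ae ?_
    filter_upwards [H.Z_mem hi hj hij] with ω hω
    rcases hω with hω | hω <;> simp [hω]
  · obtain ⟨q, hq, hq'⟩ := H.exists_edge hi hj hij
    obtain ⟨r, hr, hr'⟩ := H.exists_edge hi hk hik
    have hqr : q ≠ r := by
      rintro rfl
      rw [hq', Prod.mk.injEq] at hr'
      omega
    have hind := H.Z_indep.indepFun hqr
    rw [← hq, ← hr] at hind
    rw [hind.integral_fun_mul_eq_mul_integral (H.Z_meas i hi j hj hij).aestronglyMeasurable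
      (H.Z_meas i hi k hk hik).aestronglyMeasurable, H.integral_Z hi hj hij, H.integral_Z hi hk hik]
    ring

variable [IsProbabilityMeasure P]

lemma indep_others (H : IsRow P n p h X Z) (i : Finset.Icc 1 n) :
    Indep (MeasurableSpace.comap (X i) inferInstance) (others n X Z i) P :=
  (IndepFun_iff_Indep _ _ _).1 (indepFun_others (f := fun i : Finset.Icc 1 n => X i)
    (fun i => H.X_meas _ i.2) H.measurable_edges H.X_indep H.XZ_indep i)

lemma map_X_X (H : IsRow P n p h X Z) {i j : ℕ} (hi : i ∈ Finset.Icc 1 n)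
    (hj : j ∈ Finset.Icc 1 n) (hij : i ≠ j) :
    P.map (fun ω => (X i ω, X j ω)) = (P.map (X 1)).prod (P.map (X 1)) := by
  have h1 : IndepFun (X i) (X j) P := H.X_indep.indepFun
    (i := (⟨i, hi⟩ : Finset.Icc 1 n)) (j := ⟨j, hj⟩) (by simpa using hij)
  rw [indepFun_iff_map_prod_eq_prod_map_map (H.X_meas i hi).aemeasurable
    (H.X_meas j hj).aemeasurable] at h1
  rw [h1, H.map_X hi, H.map_X hj]

lemma isProb (H : IsRow P n p h X Z) {i : ℕ} (hi : i ∈ Finset.Icc 1 n) :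
    IsProbabilityMeasure (P.map (X 1)) := by
  rw [← H.map_X hi]
  exact Measure.isProbabilityMeasure_map (H.X_meas i hi).aemeasurable

lemma memLp_uncurry (H : IsRow P n p h X Z) {i j : ℕ} (hi : i ∈ Finset.Icc 1 n)
    (hj : j ∈ Finset.Icc 1 n) (hij : i ≠ j) :
    MemLp (Function.uncurry h) 2 ((P.map (X 1)).prod (P.map (X 1))) := by
  rw [← H.map_X_X hi hj hij, memLp_map_measure_iff H.h_meas.aestronglyMeasurable
    ((H.X_meas i hi).prodMk (H.X_meas j hj)).aemeasurable]
  exact H.memLp_h hi hj hij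

lemma measurable_proj (H : IsRow P n p h X Z) {i : ℕ} (hi : i ∈ Finset.Icc 1 n) :
    Measurable (proj P h X) := by
  have := H.isProb hi
  exact (H.h_meas.stronglyMeasurable.integral_prod_right (ν := P.map (X 1))).measurable

lemma ae_memLp_section (H : IsRow P n p h X Z) {i j : ℕ} (hi : i ∈ Finset.Icc 1 n)
    (hj : j ∈ Finset.Icc 1 n) (hij : i ≠ j) :
    ∀ᵐ x ∂(P.map (X 1)), MemLp (fun y => h x y) 2 (P.map (X 1)) := by
  have := H.isProb hi
  filter_upwards [(H.memLp_uncurry hi hj hij).integrable_sq.prod_right_ae] with x hx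
  exact (memLp_two_iff_integrable_sq
    (H.h_meas.comp measurable_prodMk_left).aestronglyMeasurable).2 hx

lemma memLp_proj (H : IsRow P n p h X Z) {i j : ℕ} (hi : i ∈ Finset.Icc 1 n)
    (hj : j ∈ Finset.Icc 1 n) (hij : i ≠ j) : MemLp (proj P h X) 2 (P.map (X 1)) := by
  have := H.isProb hi
  have hm := H.measurable_proj hi
  rw [memLp_two_iff_integrable_sq hm.aestronglyMeasurable]
  refine (H.memLp_uncurry hi hj hij).integrable_sq.integral_prod_left.mono'
    (hm.pow_const 2).aestronglyMeasurable ?_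
  filter_upwards [H.ae_memLp_section hi hj hij] with x hx
  rw [Real.norm_of_nonneg (sq_nonneg _)]
  have h1 := variance_nonneg (fun y => h x y) (P.map (X 1))
  rw [variance_eq_sub hx] at h1
  simp only [Pi.pow_apply] at h1
  simp only [Function.uncurry, proj]
  linarith

lemma memLp_proj_X (H : IsRow P n p h X Z) {i j k : ℕ} (hi : i ∈ Finset.Icc 1 n)
    (hj : j ∈ Finset.Icc 1 n) (hij : i ≠ j) (hk : k ∈ Finset.Icc 1 n) :
    MemLp (fun ω => proj P h X (X k ω)) 2 P := by
  have h1 := H.memLp_proj hi hj hij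
  rw [← H.map_X hk, memLp_map_measure_iff (H.measurable_proj hi).aestronglyMeasurable
    (H.X_meas k hk).aemeasurable] at h1
  exact h1

lemma integral_proj (H : IsRow P n p h X Z) {i j : ℕ} (hi : i ∈ Finset.Icc 1 n)
    (hj : j ∈ Finset.Icc 1 n) (hij : i ≠ j) : ∫ x, proj P h X x ∂(P.map (X 1)) = 0 := by
  have := H.isProb hi
  have h1 := integral_prod _ ((H.memLp_uncurry hi hj hij).integrable (by norm_num))
  have h2 := H.h_mean i hi j hj hij
  have h3 : ∫ ω, h (X i ω) (X j ω) ∂P = ∫ z, Function.uncurry h z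
      ∂((P.map (X 1)).prod (P.map (X 1))) := by
    rw [← H.map_X_X hi hj hij, integral_map ((H.X_meas i hi).prodMk (H.X_meas j hj)).aemeasurable
      H.h_meas.aestronglyMeasurable]
    rfl
  rw [← h2, h3, h1]
  rfl

lemma memLp_lin (H : IsRow P n p h X Z) {i j : ℕ} (hi : i ∈ Finset.Icc 1 n)
    (hj : j ∈ Finset.Icc 1 n) (hij : i ≠ j) : MemLp (lin P h X Z i j) 2 P :=
  H.memLp_Z_mul hi hj hij (H.memLp_proj_X hi hj hij hi)

lemma memLp_degen (H : IsRow P n p h X Z) {i j : ℕ} (hi : i ∈ Finset.Icc 1 n)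
    (hj : j ∈ Finset.Icc 1 n) (hij : i ≠ j) : MemLp (degen P h X Z i j) 2 P :=
  H.memLp_Z_mul hi hj hij (((H.memLp_h hi hj hij).sub (H.memLp_proj_X hi hj hij hi)).sub
    (H.memLp_proj_X hi hj hij hj))

/-- `Z_{ij} g(X_i)` is orthogonal to everything that does not involve `X_i`. -/
lemma integral_mul_lin (H : IsRow P n p h X Z) {i j : ℕ} (hi : i ∈ Finset.Icc 1 n)
    (hj : j ∈ Finset.Icc 1 n) (hij : i ≠ j) {W : Ω → ℝ}
    (hW : Measurable[others n X Z ⟨i, hi⟩] W) (hW2 : MemLp W 2 P) :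
    ∫ ω, W ω * lin P h X Z i j ω ∂P = 0 := by
  have hle := H.others_le ⟨i, hi⟩
  have hB : Measurable[others n X Z ⟨i, hi⟩] (fun ω => W ω * Z i j ω) :=
    hW.mul (H.measurable_others_Z ⟨i, hi⟩ hi hj hij)
  have hV : Measurable[others n X Z ⟨i, hi⟩] (X j) := measurable_others_X hj hij.symm
  have hk : Measurable (Function.uncurry fun x (_ : ℝ) => proj P h X x) :=
    (H.measurable_proj hi).comp measurable_fst
  have hint : Integrable (fun ω => W ω * lin P h X Z i j ω) P :=
    hW2.integrable_mul (H.memLp_lin hi hj hij)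
  have h1 := integral_mul_kernel_eq_zero (k := fun x _ => proj P h X x) (H.X_meas i hi)
    (hB.mono hle le_rfl) (H.X_meas j hj)
    (indepFun_of_measurable (H.indep_others ⟨i, hi⟩) (comap_measurable _) (hB.prodMk hV)) hk
    (by rw [H.map_X hi, H.integral_proj hi hj hij]; simp)
    (by simpa only [lin, mul_assoc] using hint)
  simpa only [lin, mul_assoc] using h1

/-- The degenerate term is orthogonal to everything that does not involve `X_i`. -/
lemma integral_mul_degen (H : IsRow P n p h X Z) {i j : ℕ} (hi : i ∈ Finset.Icc 1 n)
    (hj : j ∈ Finset.Icc 1 n) (hij : i ≠ j) {W : Ω → ℝ}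
    (hW : Measurable[others n X Z ⟨i, hi⟩] W) (hW2 : MemLp W 2 P) :
    ∫ ω, W ω * degen P h X Z i j ω ∂P = 0 := by
  have hle := H.others_le ⟨i, hi⟩
  have hB : Measurable[others n X Z ⟨i, hi⟩] (fun ω => W ω * Z i j ω) :=
    hW.mul (H.measurable_others_Z ⟨i, hi⟩ hi hj hij)
  have hV : Measurable[others n X Z ⟨i, hi⟩] (X j) := measurable_others_X hj hij.symm
  have hk : Measurable (Function.uncurry fun x v => h x v - proj P h X x - proj P h X v) :=
    (H.h_meas.sub ((H.measurable_proj hi).comp measurable_fst)).sub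
      ((H.measurable_proj hi).comp measurable_snd)
  have hint : Integrable (fun ω => W ω * degen P h X Z i j ω) P :=
    hW2.integrable_mul (H.memLp_degen hi hj hij)
  have := H.isProb hi
  have h1 := integral_mul_kernel_eq_zero (k := fun x v => h x v - proj P h X x - proj P h X v)
    (H.X_meas i hi) (hB.mono hle le_rfl) (H.X_meas j hj)
    (indepFun_of_measurable (H.indep_others ⟨i, hi⟩) (comap_measurable _) (hB.prodMk hV)) hk
    (by
      rw [H.map_X hi, H.map_X hj]
      filter_upwards [H.ae_memLp_section hi hj hij] with v hv
      have hv1 : Integrable (fun x => h x v) (P.map (X 1)) := by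
        simp_rw [fun x => H.h_symm x v]
        exact hv.integrable (by norm_num)
      have hg : Integrable (proj P h X) (P.map (X 1)) :=
        (H.memLp_proj hi hj hij).integrable (by norm_num)
      have e : ∫ x, h x v ∂(P.map (X 1)) = proj P h X v := by
        simp_rw [fun x => H.h_symm x v]
        rfl
      have hvg : Integrable (fun x => h x v - proj P h X x) (P.map (X 1)) := hv1.sub hg
      rw [integral_sub hvg (integrable_const _), integral_sub hv1 hg,
        H.integral_proj hi hj hij, e]
      simp)
    (by simpa only [degen, mul_assoc] using hint)
  simpa only [degen, mul_assoc] using h1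

end IsRow
end Row

section Row

variable {Ω : Type*} {mΩ : MeasurableSpace Ω} {P : Measure Ω} {n : ℕ} {p : unitInterval}
  {h : ℝ → ℝ → ℝ} {X : ℕ → Ω → ℝ} {Z : ℕ → ℕ → Ω → ℝ}

/-! ### The conditional expectations in a row -/

lemma setIntegral_eq_zero_of_measurable {m : MeasurableSpace Ω} [IsProbabilityMeasure P]
    (hm : m ≤ mΩ) {f : Ω → ℝ}
    (hf : ∀ W : Ω → ℝ, Measurable[m] W → MemLp W 2 P → ∫ ω, W ω * f ω ∂P = 0)
    {A : Set Ω} (hA : MeasurableSet[m] A) : ∫ ω in A, f ω ∂P = 0 := by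
  rw [← integral_indicator (hm A hA), ← hf (A.indicator 1) (measurable_one.indicator hA)
    ((memLp_const (1 : ℝ)).indicator (hm A hA))]
  congr 1 with ω
  by_cases h : ω ∈ A <;> simp [h]

namespace IsRow

/-- The Hoeffding decomposition of `Φ(i,j)`. -/
lemma Phi_eq (H : IsRow P n p h X Z) {i j : ℕ} (hi : i ∈ Finset.Icc 1 n)
    (hj : j ∈ Finset.Icc 1 n) (hij : i ≠ j) (ω : Ω) :
    Phi h X Z i j ω = degen P h X Z i j ω + lin P h X Z i j ω + lin P h X Z j i ω := by
  simp only [Phi, degen, lin, H.Z_symm j hj i hi hij.symm]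
  ring

lemma memLp_Phi (H : IsRow P n p h X Z) {i j : ℕ} (hi : i ∈ Finset.Icc 1 n)
    (hj : j ∈ Finset.Icc 1 n) (hij : i ≠ j) : MemLp (Phi h X Z i j) 2 P :=
  H.memLp_Z_mul hi hj hij (H.memLp_h hi hj hij)

lemma mem_of_mem_Ico {i j : ℕ} (hi : i ∈ Finset.Icc 1 n) (hj : j ∈ Finset.Ico 1 i) :
    j ∈ Finset.Icc 1 n ∧ j ≠ i := by
  rw [Finset.mem_Icc] at *
  rw [Finset.mem_Ico] at hj
  omega

variable [IsProbabilityMeasure P]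

lemma measurable_others_lin (H : IsRow P n p h X Z) {i j : ℕ} (hi : i ∈ Finset.Icc 1 n)
    (hj : j ∈ Finset.Icc 1 n) (hij : i ≠ j) (k : Finset.Icc 1 n) (hik : i ≠ k) :
    Measurable[others n X Z k] (lin P h X Z i j) :=
  (H.measurable_others_Z k hi hj hij).mul
    ((H.measurable_proj hi).comp (measurable_others_X hi hik))

lemma measurable_others_degen (H : IsRow P n p h X Z) {i j : ℕ} (hi : i ∈ Finset.Icc 1 n)
    (hj : j ∈ Finset.Icc 1 n) (hij : i ≠ j) (k : Finset.Icc 1 n) (hik : i ≠ k) (hjk : j ≠ k) :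
    Measurable[others n X Z k] (degen P h X Z i j) :=
  (H.measurable_others_Z k hi hj hij).mul
    (((H.h_meas.comp ((measurable_others_X hi hik).prodMk (measurable_others_X hj hjk))).sub
      ((H.measurable_proj hi).comp (measurable_others_X hi hik))).sub
      ((H.measurable_proj hi).comp (measurable_others_X hj hjk)))

/-- `Ψ_j(i) = Z_{ij} g(X_i)` almost surely. -/
lemma Psi_ae_eq (H : IsRow P n p h X Z) {i j : ℕ} (hi : i ∈ Finset.Icc 1 n)
    (hj : j ∈ Finset.Icc 1 n) (hij : i ≠ j) : Psi P h X Z j i =ᵐ[P] lin P h X Z i j := by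
  have hle : MeasurableSpace.comap (X i) inferInstance ⊔
      MeasurableSpace.comap (Z i j) inferInstance ≤ others n X Z ⟨j, hj⟩ :=
    sup_le (measurable_others_X hi hij).comap_le (H.measurable_others_Z _ hi hj hij).comap_le
  have hle' := hle.trans (H.others_le ⟨j, hj⟩)
  have il := (H.memLp_lin hi hj hij).integrable (by norm_num)
  have il' := (H.memLp_lin hj hi hij.symm).integrable (by norm_num)
  have idg := (H.memLp_degen hi hj hij).integrable (by norm_num)
  refine (ae_eq_condExp_of_forall_setIntegral_eq hle'
    ((H.memLp_Phi hi hj hij).integrable (by norm_num)) (fun s _ _ => il.integrableOn)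
    (fun s hs _ => ?_) ?_).symm
  · simp_rw [H.Phi_eq hi hj hij]
    have h1 : Integrable (fun ω => degen P h X Z i j ω + lin P h X Z i j ω) (P.restrict s) :=
      (idg.add il).integrableOn
    rw [integral_add h1 il'.integrableOn, integral_add idg.integrableOn il.integrableOn,
      setIntegral_eq_zero_of_measurable (H.others_le ⟨j, hj⟩)
        (fun W hW hW2 => H.integral_mul_lin hj hi hij.symm hW hW2) (hle s hs),
      H.degen_symm hi hj hij, setIntegral_eq_zero_of_measurable (H.others_le ⟨j, hj⟩)
        (fun W hW hW2 => H.integral_mul_degen hj hi hij.symm hW hW2) (hle s hs)]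
    ring
  · have hX : Measurable[MeasurableSpace.comap (X i) inferInstance ⊔
        MeasurableSpace.comap (Z i j) inferInstance] (X i) :=
      (comap_measurable _).mono le_sup_left le_rfl
    have hZ : Measurable[MeasurableSpace.comap (X i) inferInstance ⊔
        MeasurableSpace.comap (Z i j) inferInstance] (Z i j) :=
      (comap_measurable _).mono le_sup_right le_rfl
    exact (hZ.mul ((H.measurable_proj hi).comp hX)).stronglyMeasurable.aestronglyMeasurable

lemma PhiTilde_ae_eq (H : IsRow P n p h X Z) {i j : ℕ} (hi : i ∈ Finset.Icc 1 n)
    (hj : j ∈ Finset.Icc 1 n) (hij : i ≠ j) :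
    PhiTilde P h X Z i j =ᵐ[P] degen P h X Z i j := by
  filter_upwards [H.Psi_ae_eq hi hj hij, H.Psi_ae_eq hj hi hij.symm] with ω w1 w2
  simp only [PhiTilde]
  rw [w1, w2, H.Phi_eq hi hj hij]
  ring

lemma xi_ae_eq (H : IsRow P n p h X Z) {i : ℕ} (hi : i ∈ Finset.Icc 1 n) :
    xi P n p h X Z i =ᵐ[P] fun ω => 1 / (n * theta P n p h X Z) *
      (∑ j ∈ (Finset.Icc 1 n).erase i, lin P h X Z i j ω +
        ∑ j ∈ Finset.Ico 1 i, degen P h X Z i j ω) := by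
  have h1 : ∀ᵐ ω ∂P, ∀ j ∈ (Finset.Icc 1 n).erase i, Psi P h X Z j i ω = lin P h X Z i j ω :=
    (ae_ball_iff (Finset.countable_toSet _)).2 fun j hj =>
      H.Psi_ae_eq hi (Finset.mem_of_mem_erase hj) (Finset.ne_of_mem_erase hj).symm
  have h2 : ∀ᵐ ω ∂P, ∀ j ∈ Finset.Ico 1 i, PhiTilde P h X Z i j ω = degen P h X Z i j ω :=
    (ae_ball_iff (Finset.countable_toSet _)).2 fun j hj =>
      H.PhiTilde_ae_eq hi (mem_of_mem_Ico hi hj).1 (mem_of_mem_Ico hi hj).2.symm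
  filter_upwards [h1, h2] with ω w1 w2
  simp only [xi]
  rw [Finset.sum_congr rfl w1, Finset.sum_congr rfl w2, mul_add]

lemma memLp_sum_lin (H : IsRow P n p h X Z) {i : ℕ} (hi : i ∈ Finset.Icc 1 n) :
    MemLp (fun ω => ∑ j ∈ (Finset.Icc 1 n).erase i, lin P h X Z i j ω) 2 P :=
  memLp_finsetSum _ fun _ hj =>
    H.memLp_lin hi (Finset.mem_of_mem_erase hj) (Finset.ne_of_mem_erase hj).symm

lemma memLp_sum_degen (H : IsRow P n p h X Z) {i : ℕ} (hi : i ∈ Finset.Icc 1 n) :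
    MemLp (fun ω => ∑ j ∈ Finset.Ico 1 i, degen P h X Z i j ω) 2 P :=
  memLp_finsetSum _ fun _ hj =>
    H.memLp_degen hi (mem_of_mem_Ico hi hj).1 (mem_of_mem_Ico hi hj).2.symm

lemma memLp_xi (H : IsRow P n p h X Z) {i : ℕ} (hi : i ∈ Finset.Icc 1 n) :
    MemLp (xi P n p h X Z i) 2 P :=
  (((H.memLp_sum_lin hi).add (H.memLp_sum_degen hi)).const_mul _).ae_eq (H.xi_ae_eq hi).symm

end IsRow

lemma past_mono (n : ℕ) (X : ℕ → Ω → ℝ) (Z : ℕ → ℕ → Ω → ℝ) : Monotone (past n X Z) := by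
  intro i j hij
  have hsub := Finset.Ico_subset_Ico_right (a := 1) hij
  exact sup_le_sup (biSup_mono fun k hk => hsub hk) (biSup_mono fun k hk => hsub hk)

lemma measurable_past_X {i k : ℕ} (hk : k ∈ Finset.Ico 1 i) : Measurable[past n X Z i] (X k) :=
  (comap_measurable (X k)).mono
    (le_sup_of_le_left (le_biSup (fun k => MeasurableSpace.comap (X k) inferInstance) hk)) le_rfl

lemma measurable_past_Z {i l m : ℕ} (hl : l ∈ Finset.Ico 1 i) (hm : m ∈ (Finset.Icc 1 n).erase l) :
    Measurable[past n X Z i] (Z l m) :=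
  (comap_measurable (Z l m)).mono (le_sup_of_le_right
    (le_iSup₂_of_le l hl (le_iSup₂_of_le m hm le_rfl))) le_rfl

namespace IsRow

lemma past_le (H : IsRow P n p h X Z) {i : ℕ} (hi : i ≤ n + 1) : past n X Z i ≤ mΩ := by
  refine sup_le (iSup₂_le fun k hk => ?_) (iSup₂_le fun l hl => iSup₂_le fun m hm => ?_)
  · rw [Finset.mem_Ico] at hk
    exact (H.X_meas k (by simp; omega)).comap_le
  · rw [Finset.mem_Ico] at hl
    exact (H.Z_meas l (by simp; omega) m (Finset.mem_of_mem_erase hm)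
      (Finset.ne_of_mem_erase hm).symm).comap_le

lemma past_le_others (H : IsRow P n p h X Z) (i : Finset.Icc 1 n) :
    past n X Z i ≤ others n X Z i := by
  refine sup_le (iSup₂_le fun k hk => ?_) (iSup₂_le fun l hl => iSup₂_le fun m hm => ?_)
  · obtain ⟨h1, h2⟩ := mem_of_mem_Ico i.2 hk
    exact (measurable_others_X h1 h2).comap_le
  · exact (H.measurable_others_Z i (mem_of_mem_Ico i.2 hl).1 (Finset.mem_of_mem_erase hm)
      (Finset.ne_of_mem_erase hm).symm).comap_le

/-- `ξ_i` is determined by the past of `i + 1`. -/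
lemma stronglyMeasurable_xi (H : IsRow P n p h X Z) {i : ℕ} (hi : i ∈ Finset.Icc 1 n) :
    StronglyMeasurable[past n X Z (i + 1)] (xi P n p h X Z i) := by
  have hPsi : ∀ l m, l ∈ Finset.Ico 1 (i + 1) → m ∈ (Finset.Icc 1 n).erase l →
      StronglyMeasurable[past n X Z (i + 1)] (Psi P h X Z m l) := fun l m hl hm =>
    stronglyMeasurable_condExp.mono
      (sup_le (measurable_past_X hl).comap_le (measurable_past_Z hl hm).comap_le)
  have hi' := Finset.mem_Icc.1 hi
  have hiI : i ∈ Finset.Ico 1 (i + 1) := by simp; omega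
  refine ((Finset.stronglyMeasurable_fun_sum _ fun j hj => hPsi i j hiI hj).const_mul _).add
    ((Finset.stronglyMeasurable_fun_sum _ fun j hj => ?_).const_mul _)
  obtain ⟨h1, h2⟩ := mem_of_mem_Ico hi hj
  have hjI : j ∈ Finset.Ico 1 (i + 1) := by
    rw [Finset.mem_Ico] at *; omega
  have hji : j ∈ (Finset.Icc 1 n).erase i := Finset.mem_erase.2 ⟨h2, h1⟩
  have hPhi : Measurable[past n X Z (i + 1)] (Phi h X Z i j) :=
    (measurable_past_Z hiI hji).mul
      (H.h_meas.comp ((measurable_past_X hiI).prodMk (measurable_past_X hjI)))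
  exact (hPhi.stronglyMeasurable.sub (hPsi i j hiI hji)).sub
    (hPsi j i hjI (Finset.mem_erase.2 ⟨h2.symm, hi⟩))

lemma integral_Z_mul_Z_mul (H : IsRow P n p h X Z) {i j k a b : ℕ} (hi : i ∈ Finset.Icc 1 n)
    (hj : j ∈ Finset.Icc 1 n) (hij : i ≠ j) (hk : k ∈ Finset.Icc 1 n) (hik : i ≠ k)
    (ha : a ∈ Finset.Icc 1 n) (hb : b ∈ Finset.Icc 1 n) {f : ℝ × ℝ → ℝ} (hf : Measurable f) :
    ∫ ω, Z i j ω * Z i k ω * f (X a ω, X b ω) ∂P =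
      (if j = k then (p : ℝ) else (p : ℝ) ^ 2) * ∫ ω, f (X a ω, X b ω) ∂P := by
  obtain ⟨q, hq, -⟩ := H.exists_edge hi hj hij
  obtain ⟨r, hr, -⟩ := H.exists_edge hi hk hik
  have hind := H.XZ_indep.symm.comp
    (φ := fun z : {q : ℕ × ℕ // 1 ≤ q.1 ∧ q.1 < q.2 ∧ q.2 ≤ n} → ℝ => z q * z r)
    (ψ := fun x : Finset.Icc 1 n → ℝ => f (x ⟨a, ha⟩, x ⟨b, hb⟩)) (by fun_prop) (by fun_prop)
  rw [← H.integral_Z_mul_Z hi hj hij hk hik]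
  simp_rw [hq, hr]
  refine hind.integral_fun_mul_eq_mul_integral ?_ ?_
  · rw [Function.comp_def]
    simp_rw [← hq, ← hr]
    exact ((H.Z_meas i hi j hj hij).mul (H.Z_meas i hi k hk hik)).aestronglyMeasurable
  · exact (hf.comp ((H.X_meas a ha).prodMk (H.X_meas b hb))).aestronglyMeasurable

variable [IsProbabilityMeasure P]

/-- The `ξ_i` are martingale differences: the past of `i` does not involve `X_i`, which every term
of `ξ_i` contains and integrates to zero. The edges `Z_{ij}` need no averaging. -/
lemma condExp_xi (H : IsRow P n p h X Z) {i : ℕ} (hi : i ∈ Finset.Icc 1 n) :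
    P[xi P n p h X Z i | past n X Z i] =ᵐ[P] 0 := by
  have hle := H.past_le_others ⟨i, hi⟩
  have hle' := H.others_le ⟨i, hi⟩
  refine (ae_eq_condExp_of_forall_setIntegral_eq (hle.trans hle')
    ((H.memLp_xi hi).integrable (by norm_num)) (fun s _ _ => integrableOn_zero)
    (fun s hs _ => ?_) aestronglyMeasurable_zero).symm
  suffices hs0 : ∫ ω in s, xi P n p h X Z i ω ∂P = 0 by rw [hs0]; simp
  rw [setIntegral_congr_ae (hle' s (hle s hs)) (g := fun ω => 1 / (n * theta P n p h X Z) *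
      (∑ j ∈ (Finset.Icc 1 n).erase i, lin P h X Z i j ω +
        ∑ j ∈ Finset.Ico 1 i, degen P h X Z i j ω))
      (by filter_upwards [H.xi_ae_eq hi] with ω hω _ using hω),
    integral_const_mul, integral_add ((H.memLp_sum_lin hi).integrable (by norm_num)).integrableOn
      ((H.memLp_sum_degen hi).integrable (by norm_num)).integrableOn,
    integral_finsetSum _ (fun j hj => ((H.memLp_lin hi (Finset.mem_of_mem_erase hj)
      (Finset.ne_of_mem_erase hj).symm).integrable (by norm_num)).integrableOn),
    integral_finsetSum _ (fun j hj => ((H.memLp_degen hi (mem_of_mem_Ico hi hj).1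
      (mem_of_mem_Ico hi hj).2.symm).integrable (by norm_num)).integrableOn),
    Finset.sum_eq_zero, Finset.sum_eq_zero]
  · simp
  · intro j hj
    exact setIntegral_eq_zero_of_measurable hle' (fun W hW hW2 => H.integral_mul_degen hi
      (mem_of_mem_Ico hi hj).1 (mem_of_mem_Ico hi hj).2.symm hW hW2) (hle s hs)
  · intro j hj
    exact setIntegral_eq_zero_of_measurable hle' (fun W hW hW2 => H.integral_mul_lin hi
      (Finset.mem_of_mem_erase hj) (Finset.ne_of_mem_erase hj).symm hW hW2) (hle s hs)

/-! ### Second moments -/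

lemma integral_lin_mul_lin (H : IsRow P n p h X Z) {i j k : ℕ} (hi : i ∈ Finset.Icc 1 n)
    (hj : j ∈ Finset.Icc 1 n) (hij : i ≠ j) (hk : k ∈ Finset.Icc 1 n) (hik : i ≠ k) :
    ∫ ω, lin P h X Z i j ω * lin P h X Z i k ω ∂P =
      (if j = k then (p : ℝ) else (p : ℝ) ^ 2) * ∫ x, proj P h X x ^ 2 ∂(P.map (X 1)) := by
  have hg := H.measurable_proj hi
  rw [← H.map_X hi, integral_map (H.X_meas i hi).aemeasurable
    (hg.pow_const 2).aestronglyMeasurable, ← H.integral_Z_mul_Z_mul hi hj hij hk hik hi hi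
      (f := fun z => proj P h X z.1 ^ 2) ((hg.comp measurable_fst).pow_const 2)]
  congr 1 with ω
  simp only [lin]
  ring

lemma integral_Phi_sq (H : IsRow P n p h X Z) {i j : ℕ} (hi : i ∈ Finset.Icc 1 n)
    (hj : j ∈ Finset.Icc 1 n) (hij : i ≠ j) :
    ∫ ω, Phi h X Z i j ω ^ 2 ∂P =
      p * ∫ z, Function.uncurry h z ^ 2 ∂((P.map (X 1)).prod (P.map (X 1))) := by
  rw [← H.map_X_X hi hj hij, integral_map ((H.X_meas i hi).prodMk (H.X_meas j hj)).aemeasurable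
    (H.h_meas.pow_const 2).aestronglyMeasurable]
  have := H.integral_Z_mul_Z_mul hi hj hij hj hij hi hj
    (f := fun z => Function.uncurry h z ^ 2) (H.h_meas.pow_const 2)
  rw [if_pos rfl] at this
  rw [← this]
  congr 1 with ω
  simp only [Phi, Function.uncurry]
  ring

lemma integral_lin_mul_degen (H : IsRow P n p h X Z) {i j k : ℕ} (hi : i ∈ Finset.Icc 1 n)
    (hj : j ∈ Finset.Icc 1 n) (hij : i ≠ j) (hk : k ∈ Finset.Icc 1 n) (hik : i ≠ k) :
    ∫ ω, lin P h X Z i k ω * degen P h X Z i j ω ∂P = 0 := by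
  rw [H.degen_symm hi hj hij]
  exact H.integral_mul_degen hj hi hij.symm (H.measurable_others_lin hi hk hik ⟨j, hj⟩ hij)
    (H.memLp_lin hi hk hik)

lemma integral_degen_mul_degen (H : IsRow P n p h X Z) {i j k : ℕ} (hi : i ∈ Finset.Icc 1 n)
    (hj : j ∈ Finset.Icc 1 n) (hij : i ≠ j) (hk : k ∈ Finset.Icc 1 n) (hik : i ≠ k)
    (hjk : j ≠ k) : ∫ ω, degen P h X Z i j ω * degen P h X Z i k ω ∂P = 0 := by
  rw [H.degen_symm hi hk hik]
  exact H.integral_mul_degen hk hi hik.symm (H.measurable_others_degen hi hj hij ⟨k, hk⟩ hik hjk)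
    (H.memLp_degen hi hj hij)

/-- The three terms of the Hoeffding decomposition of `Φ(i,j)` are orthogonal, so the second moment
of the degenerate one is `β² - 2γ²`. -/
lemma integral_degen_sq (H : IsRow P n p h X Z) {i j : ℕ} (hi : i ∈ Finset.Icc 1 n)
    (hj : j ∈ Finset.Icc 1 n) (hij : i ≠ j) :
    ∫ ω, degen P h X Z i j ω * degen P h X Z i j ω ∂P =
      p * ∫ z, Function.uncurry h z ^ 2 ∂((P.map (X 1)).prod (P.map (X 1))) -
        2 * (p * ∫ x, proj P h X x ^ 2 ∂(P.map (X 1))) := by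
  have md := H.memLp_degen hi hj hij
  have m1 := H.memLp_lin hi hj hij
  have m2 := H.memLp_lin hj hi hij.symm
  have e1 := H.integral_lin_mul_degen hi hj hij hj hij
  have e2 := H.integral_lin_mul_degen hj hi hij.symm hi hij.symm
  rw [H.degen_symm hj hi hij.symm] at e2
  have e3 := H.integral_mul_lin hi hj hij (H.measurable_others_lin hj hi hij.symm ⟨i, hi⟩ hij.symm)
    m2
  have e4 := H.integral_lin_mul_lin hi hj hij hj hij
  have e5 := H.integral_lin_mul_lin hj hi hij.symm hi hij.symm
  rw [if_pos rfl] at e4 e5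
  rw [← H.integral_Phi_sq hi hj hij]
  have i1 : Integrable (fun ω => degen P h X Z i j ω * degen P h X Z i j ω) P :=
    md.integrable_mul md
  have i2 : Integrable (fun ω => lin P h X Z i j ω * lin P h X Z i j ω) P := m1.integrable_mul m1
  have i3 : Integrable (fun ω => lin P h X Z j i ω * lin P h X Z j i ω) P := m2.integrable_mul m2
  have i4 : Integrable (fun ω => lin P h X Z i j ω * degen P h X Z i j ω) P := m1.integrable_mul md
  have i5 : Integrable (fun ω => lin P h X Z j i ω * degen P h X Z i j ω) P := m2.integrable_mul md
  have i6 : Integrable (fun ω => lin P h X Z j i ω * lin P h X Z i j ω) P := m2.integrable_mul m1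
  have hid : ∀ ω, degen P h X Z i j ω * degen P h X Z i j ω = Phi h X Z i j ω ^ 2 -
      (lin P h X Z i j ω * lin P h X Z i j ω + lin P h X Z j i ω * lin P h X Z j i ω +
        2 * (lin P h X Z i j ω * degen P h X Z i j ω + lin P h X Z j i ω * degen P h X Z i j ω +
          lin P h X Z j i ω * lin P h X Z i j ω)) := fun ω => by
    rw [H.Phi_eq hi hj hij]; ring
  have i45 : Integrable (fun ω => lin P h X Z i j ω * degen P h X Z i j ω +
      lin P h X Z j i ω * degen P h X Z i j ω) P := i4.add i5
  have i456 : Integrable (fun ω => 2 * (lin P h X Z i j ω * degen P h X Z i j ω +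
      lin P h X Z j i ω * degen P h X Z i j ω + lin P h X Z j i ω * lin P h X Z i j ω)) P :=
    (i45.add i6).const_mul 2
  have iR : Integrable (fun ω => lin P h X Z i j ω * lin P h X Z i j ω +
      lin P h X Z j i ω * lin P h X Z j i ω + 2 * (lin P h X Z i j ω * degen P h X Z i j ω +
      lin P h X Z j i ω * degen P h X Z i j ω + lin P h X Z j i ω * lin P h X Z i j ω)) P :=
    (i2.add i3).add i456
  have i23 : Integrable (fun ω => lin P h X Z i j ω * lin P h X Z i j ω +
      lin P h X Z j i ω * lin P h X Z j i ω) P := i2.add i3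
  simp_rw [hid]
  rw [integral_sub (H.memLp_Phi hi hj hij).integrable_sq iR, integral_add i23 i456,
    integral_add i2 i3, integral_const_mul, integral_add i45 i6, integral_add i4 i5, e1, e2, e3,
    e4, e5]
  ring

lemma gammaSq_eq (H : IsRow P n p h X Z) (hn : 2 ≤ n) :
    gammaSq P h X Z = p * ∫ x, proj P h X x ^ 2 ∂(P.map (X 1)) := by
  have h1 : 1 ∈ Finset.Icc 1 n := by simp; omega
  have h2 : 2 ∈ Finset.Icc 1 n := by simp; omega
  have e := H.integral_lin_mul_lin h1 h2 (by norm_num) h2 (by norm_num)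
  rw [if_pos rfl] at e
  rw [← e, gammaSq]
  refine integral_congr_ae ?_
  filter_upwards [H.Psi_ae_eq h1 h2 (by norm_num)] with ω w
  rw [w, sq]

lemma betaSq_eq (H : IsRow P n p h X Z) (hn : 2 ≤ n) :
    betaSq P h X Z =
      p * ∫ z, Function.uncurry h z ^ 2 ∂((P.map (X 1)).prod (P.map (X 1))) :=
  H.integral_Phi_sq (i := 1) (j := 2) (by simp; omega) (by simp; omega) (by norm_num)

end IsRow

lemma integral_sum_mul_sum {ι κ : Type*} {s : Finset ι} {t : Finset κ} {f : ι → Ω → ℝ}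
    {g : κ → Ω → ℝ} (hf : ∀ i ∈ s, MemLp (f i) 2 P) (hg : ∀ j ∈ t, MemLp (g j) 2 P) :
    ∫ ω, (∑ i ∈ s, f i ω) * ∑ j ∈ t, g j ω ∂P = ∑ i ∈ s, ∑ j ∈ t, ∫ ω, f i ω * g j ω ∂P := by
  have hi : ∀ i ∈ s, ∀ j ∈ t, Integrable (fun ω => f i ω * g j ω) P := fun i hi j hj =>
    (hf i hi).integrable_mul (hg j hj)
  simp_rw [Finset.sum_mul_sum]
  rw [integral_finsetSum _ fun i h => integrable_finsetSum _ (hi i h)]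
  exact Finset.sum_congr rfl fun i h => integral_finsetSum _ (hi i h)

lemma sum_Icc_sub_one (n : ℕ) : ∑ i ∈ Finset.Icc 1 n, ((i : ℝ) - 1) = n * (n - 1) / 2 := by
  induction n with
  | zero => simp
  | succ n ih =>
    rw [Finset.sum_Icc_succ_top (by omega), ih]
    push_cast
    ring

namespace IsRow

variable [IsProbabilityMeasure P]

lemma integral_xi_sq (H : IsRow P n p h X Z) (hn : 2 ≤ n) {i : ℕ} (hi : i ∈ Finset.Icc 1 n) :
    ∫ ω, xi P n p h X Z i ω * xi P n p h X Z i ω ∂P = (1 / (n * theta P n p h X Z)) ^ 2 *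
      ((n - 1) * (1 + (n - 2) * p) * gammaSq P h X Z +
        (i - 1) * (betaSq P h X Z - 2 * gammaSq P h X Z)) := by
  set c := 1 / (n * theta P n p h X Z) with hc
  have hmem : ∀ j ∈ (Finset.Icc 1 n).erase i, j ∈ Finset.Icc 1 n ∧ i ≠ j := fun j hj =>
    ⟨Finset.mem_of_mem_erase hj, (Finset.ne_of_mem_erase hj).symm⟩
  have hmem' : ∀ j ∈ Finset.Ico 1 i, j ∈ Finset.Icc 1 n ∧ i ≠ j := fun j hj =>
    ⟨(mem_of_mem_Ico hi hj).1, (mem_of_mem_Ico hi hj).2.symm⟩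
  have hL := H.memLp_sum_lin hi
  have hQ := H.memLp_sum_degen hi
  have mL : ∀ j ∈ (Finset.Icc 1 n).erase i, MemLp (lin P h X Z i j) 2 P := fun j hj =>
    H.memLp_lin hi (hmem j hj).1 (hmem j hj).2
  have mQ : ∀ j ∈ Finset.Ico 1 i, MemLp (degen P h X Z i j) 2 P := fun j hj =>
    H.memLp_degen hi (hmem' j hj).1 (hmem' j hj).2
  set L : Ω → ℝ := fun ω => ∑ j ∈ (Finset.Icc 1 n).erase i, lin P h X Z i j ω with hLdef
  set Q : Ω → ℝ := fun ω => ∑ j ∈ Finset.Ico 1 i, degen P h X Z i j ω with hQdef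
  have cL : ((Finset.Icc 1 n).erase i).card = (n : ℝ) - 1 := by
    rw [Finset.card_erase_of_mem hi, Nat.card_Icc, Nat.add_sub_cancel, Nat.cast_pred (by omega)]
  have cQ : (Finset.Ico 1 i).card = (i : ℝ) - 1 := by
    rw [Nat.card_Ico, Nat.cast_pred (Finset.mem_Icc.1 hi).1]
  have eLL : ∫ ω, L ω * L ω ∂P = (n - 1) * (1 + (n - 2) * p) * gammaSq P h X Z := by
    rw [integral_sum_mul_sum mL mL]
    have : ∀ j ∈ (Finset.Icc 1 n).erase i, ∑ k ∈ (Finset.Icc 1 n).erase i,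
        ∫ ω, lin P h X Z i j ω * lin P h X Z i k ω ∂P =
          (1 + (n - 2) * p) * gammaSq P h X Z := by
      intro j hj
      rw [Finset.sum_congr rfl fun k hk => H.integral_lin_mul_lin hi (hmem j hj).1 (hmem j hj).2
        (hmem k hk).1 (hmem k hk).2, ← Finset.sum_mul]
      have hs : ∀ k, (if j = k then (p : ℝ) else (p : ℝ) ^ 2) =
          (p : ℝ) ^ 2 + if j = k then (p : ℝ) - (p : ℝ) ^ 2 else 0 := fun k => by
        split_ifs <;> ring
      simp_rw [hs]
      rw [Finset.sum_add_distrib, Finset.sum_ite_eq, if_pos hj, Finset.sum_const, nsmul_eq_mul,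
        cL, H.gammaSq_eq hn]
      ring
    rw [Finset.sum_congr rfl this, Finset.sum_const, nsmul_eq_mul, cL]
    ring
  have eLQ : ∫ ω, L ω * Q ω ∂P = 0 := by
    rw [integral_sum_mul_sum mL mQ]
    exact Finset.sum_eq_zero fun k hk => Finset.sum_eq_zero fun j hj =>
      H.integral_lin_mul_degen hi (hmem' j hj).1 (hmem' j hj).2 (hmem k hk).1 (hmem k hk).2
  have eQQ : ∫ ω, Q ω * Q ω ∂P = (i - 1) * (betaSq P h X Z - 2 * gammaSq P h X Z) := by
    rw [integral_sum_mul_sum mQ mQ]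
    have : ∀ j ∈ Finset.Ico 1 i, ∑ k ∈ Finset.Ico 1 i,
        ∫ ω, degen P h X Z i j ω * degen P h X Z i k ω ∂P =
          betaSq P h X Z - 2 * gammaSq P h X Z := by
      intro j hj
      rw [Finset.sum_eq_single_of_mem j hj fun k hk hkj =>
        H.integral_degen_mul_degen hi (hmem' j hj).1 (hmem' j hj).2 (hmem' k hk).1 (hmem' k hk).2
          hkj.symm, H.integral_degen_sq hi (hmem' j hj).1 (hmem' j hj).2, H.gammaSq_eq hn,
          H.betaSq_eq hn]
    rw [Finset.sum_congr rfl this, Finset.sum_const, nsmul_eq_mul, cQ]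
  have iLL : Integrable (fun ω => L ω * L ω) P := hL.integrable_mul hL
  have iLQ : Integrable (fun ω => L ω * Q ω) P := hL.integrable_mul hQ
  have iQQ : Integrable (fun ω => Q ω * Q ω) P := hQ.integrable_mul hQ
  have iS : Integrable (fun ω => L ω * L ω + 2 * (L ω * Q ω)) P := iLL.add (iLQ.const_mul 2)
  have hexp : ∫ ω, xi P n p h X Z i ω * xi P n p h X Z i ω ∂P =
      ∫ ω, c ^ 2 * ((L ω * L ω + 2 * (L ω * Q ω)) + Q ω * Q ω) ∂P := by
    refine integral_congr_ae ?_
    filter_upwards [H.xi_ae_eq hi] with ω hω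
    rw [hω]
    simp only [hLdef, hQdef]
    ring
  rw [hexp, integral_const_mul, integral_add iS iQQ, integral_add iLL (iLQ.const_mul 2),
    integral_const_mul, eLL, eLQ, eQQ]
  ring

lemma integral_xi (H : IsRow P n p h X Z) {i : ℕ} (hi : i ∈ Finset.Icc 1 n) :
    ∫ ω, xi P n p h X Z i ω ∂P = 0 := by
  rw [← integral_condExp (H.past_le (by rw [Finset.mem_Icc] at hi; omega : i ≤ n + 1)),
    integral_congr_ae (H.condExp_xi hi)]
  simp

lemma integral_xi_mul_xi_of_lt (H : IsRow P n p h X Z) {i j : ℕ} (hi : i ∈ Finset.Icc 1 n)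
    (hj : j ∈ Finset.Icc 1 n) (hij : i < j) :
    ∫ ω, xi P n p h X Z i ω * xi P n p h X Z j ω ∂P = 0 := by
  have hm := (H.stronglyMeasurable_xi hi).mono (past_mono n X Z hij)
  have h1 := condExp_mul_of_stronglyMeasurable_left hm
    ((H.memLp_xi hi).integrable_mul (H.memLp_xi hj)) ((H.memLp_xi hj).integrable (by norm_num))
  change ∫ ω, (xi P n p h X Z i * xi P n p h X Z j) ω ∂P = 0
  rw [← integral_condExp (H.past_le (by rw [Finset.mem_Icc] at hj; omega : j ≤ n + 1)),
    integral_congr_ae h1]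
  refine integral_eq_zero_of_ae ?_
  filter_upwards [H.condExp_xi hj] with ω hω
  simp [hω]

lemma memLp_sum_xi (H : IsRow P n p h X Z) :
    MemLp (fun ω => ∑ i ∈ Finset.Icc 1 n, xi P n p h X Z i ω) 2 P :=
  memLp_finsetSum _ fun _ hi => H.memLp_xi hi

/-- Martingale differences are uncorrelated, so the second moments of the `ξ_i` add up. -/
lemma variance_sum_xi (H : IsRow P n p h X Z) (hn : 2 ≤ n) :
    variance (fun ω => ∑ i ∈ Finset.Icc 1 n, xi P n p h X Z i ω) P =
      (1 / (n * theta P n p h X Z)) ^ 2 *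
        (n * (n - 1) * ((n - 2) * p * gammaSq P h X Z + betaSq P h X Z / 2)) := by
  rw [variance_eq_sub H.memLp_sum_xi, integral_finsetSum _ fun i hi =>
    (H.memLp_xi hi).integrable (by norm_num), Finset.sum_eq_zero fun i hi => H.integral_xi hi]
  have h1 : ∫ ω, ((fun ω => ∑ i ∈ Finset.Icc 1 n, xi P n p h X Z i ω) ^ 2) ω ∂P =
      ∑ i ∈ Finset.Icc 1 n, ∫ ω, xi P n p h X Z i ω * xi P n p h X Z i ω ∂P := by
    simp only [Pi.pow_apply, sq]
    rw [integral_sum_mul_sum (fun _ hi => H.memLp_xi hi) (fun _ hi => H.memLp_xi hi)]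
    refine Finset.sum_congr rfl fun i hi => Finset.sum_eq_single_of_mem i hi fun j hj hji => ?_
    rcases lt_or_gt_of_ne hji with hlt | hlt
    · simp_rw [mul_comm (xi P n p h X Z i _)]
      exact H.integral_xi_mul_xi_of_lt hj hi hlt
    · exact H.integral_xi_mul_xi_of_lt hi hj hlt
  rw [h1, Finset.sum_congr rfl fun i hi => H.integral_xi_sq hn hi, ← Finset.mul_sum,
    Finset.sum_add_distrib, Finset.sum_const, ← Finset.sum_mul, sum_Icc_sub_one]
  simp only [Nat.card_Icc, add_tsub_cancel_right, nsmul_eq_mul]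
  ring

end IsRow
end Row

/-! ### Convergence of the standardized incomplete U-statistic -/

section Row

variable {Ω : Type*} {mΩ : MeasurableSpace Ω} {P : Measure Ω} {n : ℕ} {p : unitInterval}
  {h : ℝ → ℝ → ℝ} {X : ℕ → Ω → ℝ} {Z : ℕ → ℕ → Ω → ℝ}

lemma sum_Ioc_comm (n : ℕ) (F : ℕ → ℕ → ℝ) :
    ∑ i ∈ Finset.Icc 1 n, ∑ j ∈ Finset.Ioc i n, F i j =
      ∑ i ∈ Finset.Icc 1 n, ∑ j ∈ Finset.Ico 1 i, F j i :=
  Finset.sum_comm' fun i j => by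
    simp only [Finset.mem_Icc, Finset.mem_Ioc, Finset.mem_Ico]
    omega

lemma sum_erase_eq (F : ℕ → ℝ) {i : ℕ} (hi : i ∈ Finset.Icc 1 n) :
    ∑ j ∈ (Finset.Icc 1 n).erase i, F j =
      ∑ j ∈ Finset.Ico 1 i, F j + ∑ j ∈ Finset.Ioc i n, F j := by
  rw [← Finset.sum_union]
  · congr 1
    ext j
    simp only [Finset.mem_erase, Finset.mem_union, Finset.mem_Icc, Finset.mem_Ioc, Finset.mem_Ico]
      at hi ⊢
    omega
  · rw [Finset.disjoint_left]
    intro j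
    simp only [Finset.mem_Ioc, Finset.mem_Ico]
    omega

lemma sum_range_succ_eq_sum_Icc (F : ℕ → ℝ) (n : ℕ) :
    ∑ k ∈ Finset.range n, F (k + 1) = ∑ i ∈ Finset.Icc 1 n, F i := by
  rw [Finset.range_eq_Ico, Finset.sum_Ico_add']
  rfl

lemma theta_sq (P : Measure Ω) (n : ℕ) (p : unitInterval) (h : ℝ → ℝ → ℝ) (X : ℕ → Ω → ℝ)
    (Z : ℕ → ℕ → Ω → ℝ) :
    theta P n p h X Z ^ 2 = n * p * gammaSq P h X Z + betaSq P h X Z / 2 := by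
  have h1 : 0 ≤ gammaSq P h X Z := integral_nonneg fun _ => sq_nonneg _
  have h2 : 0 ≤ betaSq P h X Z := integral_nonneg fun _ => sq_nonneg _
  have h3 : 0 ≤ (p : ℝ) := p.2.1
  exact Real.sq_sqrt (by positivity)

lemma eta2_eq_zero_of_theta_eq_zero (hθ : theta P n p h X Z = 0) : eta2 P n p h X Z = 0 := by
  have hxi : ∀ i, (fun ω => xi P n p h X Z i ω ^ 2) = 0 := fun i => by
    ext ω
    simp [xi, hθ]
  ext ω
  simp only [eta2, hxi, condExp_zero]
  simp

namespace IsRow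

/-- Summing the Hoeffding decomposition over all pairs. -/
lemma U_eq_sum_xi (H : IsRow P n p h X Z) (hn : n ≠ 0) (hθ : theta P n p h X Z ≠ 0) (ω : Ω) :
    U n h X Z ω = ((n.choose 2 : ℕ) : ℝ)⁻¹ * (n * theta P n p h X Z) *
      ∑ i ∈ Finset.Icc 1 n, xi P n p h X Z i ω := by
  have hc : (n : ℝ) * theta P n p h X Z ≠ 0 := mul_ne_zero (by exact_mod_cast hn) hθ
  have h1 : ∑ i ∈ Finset.Icc 1 n, xi P n p h X Z i ω = 1 / (n * theta P n p h X Z) *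
      ∑ i ∈ Finset.Icc 1 n, (∑ j ∈ (Finset.Icc 1 n).erase i, Psi P h X Z j i ω +
        ∑ j ∈ Finset.Ico 1 i, PhiTilde P h X Z i j ω) := by
    rw [Finset.mul_sum]
    exact Finset.sum_congr rfl fun i _ => (mul_add _ _ _).symm
  have h2 : ∑ i ∈ Finset.Icc 1 n, (∑ j ∈ (Finset.Icc 1 n).erase i, Psi P h X Z j i ω +
        ∑ j ∈ Finset.Ico 1 i, PhiTilde P h X Z i j ω) =
      ∑ i ∈ Finset.Icc 1 n, ∑ j ∈ Finset.Ioc i n, Phi h X Z i j ω := by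
    have hs := sum_Ioc_comm n fun i j => Psi P h X Z j i ω
    rw [sum_Ioc_comm n fun i j => Phi h X Z i j ω, Finset.sum_add_distrib,
      Finset.sum_congr rfl fun i hi => sum_erase_eq (fun j => Psi P h X Z j i ω) hi,
      Finset.sum_add_distrib, hs, ← Finset.sum_add_distrib, ← Finset.sum_add_distrib]
    refine Finset.sum_congr rfl fun i hi => ?_
    rw [← Finset.sum_add_distrib, ← Finset.sum_add_distrib]
    refine Finset.sum_congr rfl fun j hj => ?_
    obtain ⟨hj1, hji⟩ := mem_of_mem_Ico hi hj
    have : Phi h X Z j i ω = Phi h X Z i j ω := by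
      simp only [Phi]
      rw [H.Z_symm j hj1 i hi hji, H.h_symm]
    simp only [PhiTilde, this]
    ring
  rw [h1, h2, U]
  field_simp

lemma measurable_U (H : IsRow P n p h X Z) : Measurable (U n h X Z) := by
  refine (Finset.measurable_fun_sum _ fun i hi =>
    Finset.measurable_fun_sum _ fun j hj => ?_).const_mul _
  rw [Finset.mem_Icc] at hi
  rw [Finset.mem_Ioc] at hj
  have hi' : i ∈ Finset.Icc 1 n := by simp; omega
  have hj' : j ∈ Finset.Icc 1 n := by simp; omega
  exact (H.Z_meas i hi' j hj' (by omega)).mul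
    (H.h_meas.comp ((H.X_meas i hi').prodMk (H.X_meas j hj')))

/-- The standardization does not depend on the scale, so `U` may be replaced by `∑ ξ_i`. -/
lemma U_div_sqrt_variance (H : IsRow P n p h X Z) (hn : 2 ≤ n) (hθ : theta P n p h X Z ≠ 0)
    (ω : Ω) : U n h X Z ω / Real.sqrt (variance (U n h X Z) P) =
      (∑ i ∈ Finset.Icc 1 n, xi P n p h X Z i ω) *
        (Real.sqrt (variance (fun ω => ∑ i ∈ Finset.Icc 1 n, xi P n p h X Z i ω) P))⁻¹ := by
  set K : ℝ := ((n.choose 2 : ℕ) : ℝ)⁻¹ * (n * theta P n p h X Z) with hK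
  have hθ0 : 0 < theta P n p h X Z := lt_of_le_of_ne (Real.sqrt_nonneg _) hθ.symm
  have hch : 0 < ((n.choose 2 : ℕ) : ℝ) := by exact_mod_cast Nat.choose_pos hn
  have hn0 : (0 : ℝ) < n := by exact_mod_cast (by omega : 0 < n)
  have hK0 : 0 < K := by positivity
  have hU : U n h X Z = fun ω => K * ∑ i ∈ Finset.Icc 1 n, xi P n p h X Z i ω :=
    funext fun ω => H.U_eq_sum_xi (by omega) hθ ω
  rw [hU, variance_const_mul, Real.sqrt_mul (sq_nonneg _), Real.sqrt_sq hK0.le,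
    mul_div_mul_left _ _ hK0.ne', div_eq_mul_inv]

/-- The filtration of one row, kept constant after the last index. -/
def filtration (H : IsRow P n p h X Z) : Filtration ℕ mΩ where
  seq k := past n X Z (min k n + 1)
  mono' _ _ hij := past_mono n X Z (Nat.add_le_add_right (min_le_min_right n hij) 1)
  le' k := H.past_le (Nat.add_le_add_right (min_le_right k n) 1)

lemma filtration_of_le (H : IsRow P n p h X Z) {k : ℕ} (hk : k ≤ n) :
    H.filtration k = past n X Z (k + 1) := by
  change past n X Z (min k n + 1) = _
  rw [min_eq_left hk]

variable [IsProbabilityMeasure P]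

/-- The variance of `∑ ξ_i` differs from `1` by at most `O(1/n)`. -/
lemma variance_sum_xi_mem_Icc (H : IsRow P n p h X Z) (hn : 2 ≤ n) (hθ : theta P n p h X Z ≠ 0) :
    variance (fun ω => ∑ i ∈ Finset.Icc 1 n, xi P n p h X Z i ω) P ∈
      Set.Icc ((1 - 1 / (n : ℝ)) * (1 - 2 / (n : ℝ))) 1 := by
  have hn' : (2 : ℝ) ≤ n := by exact_mod_cast hn
  have hn0 : (0 : ℝ) < n := by linarith
  have hγ : 0 ≤ p * gammaSq P h X Z :=
    mul_nonneg p.2.1 (integral_nonneg fun _ => sq_nonneg _)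
  have hβ : 0 ≤ betaSq P h X Z := integral_nonneg fun _ => sq_nonneg _
  have hθ2 := theta_sq P n p h X Z
  have hθpos : 0 < theta P n p h X Z ^ 2 := by positivity
  set A := p * gammaSq P h X Z with hA
  set B := betaSq P h X Z / 2 with hB
  have hB0 : 0 ≤ B := by positivity
  have hθ2' : theta P n p h X Z ^ 2 = n * A + B := by rw [hθ2, hA]; ring
  have hv : variance (fun ω => ∑ i ∈ Finset.Icc 1 n, xi P n p h X Z i ω) P =
      (n * (n - 1) * ((n - 2) * A + B)) / (n ^ 2 * (n * A + B)) := by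
    rw [H.variance_sum_xi hn, ← hθ2', hA, hB, div_pow, mul_pow, one_pow, one_div_mul_eq_div]
    congr 1
    ring
  rw [hθ2'] at hθpos
  rw [hv, Set.mem_Icc, div_le_one (by positivity), le_div_iff₀ (by positivity)]
  constructor
  · have : (1 - 1 / (n : ℝ)) * (1 - 2 / (n : ℝ)) * (n ^ 2 * (n * A + B)) =
        (n - 1) * ((n - 2) * (n * A + B)) := by
      field_simp
    rw [this]
    nlinarith [mul_nonneg (by linarith : (0 : ℝ) ≤ n - 1) hB0]
  · have h1 : (n : ℝ) * (n - 1) ≤ n ^ 2 := by nlinarith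
    have h2 : (n - 2) * A + B ≤ n * A + B := by nlinarith
    have h3 : 0 ≤ (n - 2) * A + B := by nlinarith
    exact mul_le_mul h1 h2 h3 (by positivity)

end IsRow

end Row

section Limit

variable {Ω : Type*} [MeasurableSpace Ω] {P : Measure Ω} [IsProbabilityMeasure P]
  {X : ℕ → ℕ → Ω → ℝ} {Z : ℕ → ℕ → ℕ → Ω → ℝ} {h : ℕ → ℝ → ℝ → ℝ} {p : ℕ → unitInterval}

/-- The martingale central limit theorem applied to the rows `ξ_1, …, ξ_n`. -/
lemma tendstoInDistribution_sum_xi (H : ∀ n, IsRow P n (p n) (h n) (X n) (Z n))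
    (hB1 : ∀ ε : ℝ, 0 < ε → TendstoInMeasure P
      (fun n => eta1 P n (p n) (h n) (X n) (Z n) ε) atTop (fun _ => 0))
    (hB2 : TendstoInMeasure P
      (fun n => eta2 P n (p n) (h n) (X n) (Z n)) atTop (fun _ => 1)) :
    TendstoInDistribution
      (fun n ω => ∑ i ∈ Finset.Icc 1 n, xi P n (p n) (h n) (X n) (Z n) i ω)
      atTop (id : ℝ → ℝ) (fun _ => P) (gaussianReal 0 1) := by
  have hmem : ∀ n k, k < n → k + 1 ∈ Finset.Icc 1 n := fun n k hk => by simp; omega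
  have h1 : ∀ n (F : ℕ → (Ω → ℝ)) ω,
      ∑ k ∈ Finset.range n, (P[F (k + 1) | (H n).filtration k]) ω =
        ∑ i ∈ Finset.Icc 1 n, (P[F i | past n (X n) (Z n) i]) ω := fun n F ω => by
    rw [← sum_range_succ_eq_sum_Icc]
    refine Finset.sum_congr rfl fun k hk => ?_
    rw [(H n).filtration_of_le (Finset.mem_range.1 hk).le]
  have hclt := tendstoInDistribution_sum_of_martingaleDifference (P := P)
    (fun n => (H n).filtration) (fun n => n)
    (d := fun n k => xi P n (p n) (h n) (X n) (Z n) (k + 1))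
    (fun n k hk => by
      rw [(H n).filtration_of_le hk]
      exact (H n).stronglyMeasurable_xi (hmem n k hk))
    (fun n k hk => (H n).memLp_xi (hmem n k hk))
    (fun n k hk => by
      rw [(H n).filtration_of_le hk.le]
      exact (H n).condExp_xi (hmem n k hk))
    (fun ε hε => by
      refine (hB1 ε hε).congr_left fun n => ae_of_all _ fun ω => ?_
      exact (h1 n (fun i => tailSq (xi P n (p n) (h n) (X n) (Z n) i) ε) ω).symm)
    (by
      refine hB2.congr_left fun n => ae_of_all _ fun ω => ?_
      exact (h1 n (fun i ω => xi P n (p n) (h n) (X n) (Z n) i ω ^ 2) ω).symm)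
  refine hclt.congr (fun n => ae_of_all _ fun ω => ?_) (ae_eq_refl _)
  exact sum_range_succ_eq_sum_Icc (fun i => xi P n (p n) (h n) (X n) (Z n) i ω) n

/-- Asymptotically unit conditional variance rules out the degenerate case `θ = 0`. -/
lemma eventually_theta_ne_zero (hB2 : TendstoInMeasure P
      (fun n => eta2 P n (p n) (h n) (X n) (Z n)) atTop (fun _ => 1)) :
    ∀ᶠ n in atTop, theta P n (p n) (h n) (X n) (Z n) ≠ 0 := by
  filter_upwards [((tendstoInMeasure_iff_measureReal_norm.1 hB2) 1 one_pos).eventually_lt_const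
    one_pos] with n hn hθ
  rw [eta2_eq_zero_of_theta_eq_zero hθ] at hn
  simp at hn

lemma tendsto_variance_sum_xi (H : ∀ n, IsRow P n (p n) (h n) (X n) (Z n))
    (hθ : ∀ᶠ n in atTop, theta P n (p n) (h n) (X n) (Z n) ≠ 0) :
    Tendsto (fun n => variance
      (fun ω => ∑ i ∈ Finset.Icc 1 n, xi P n (p n) (h n) (X n) (Z n) i ω) P) atTop (𝓝 1) := by
  have hlow : Tendsto (fun n : ℕ => (1 - 1 / (n : ℝ)) * (1 - 2 / (n : ℝ))) atTop (𝓝 1) := by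
    have h1 := (tendsto_const_div_atTop_nhds_zero_nat (1 : ℝ)).const_sub 1
    have h2 := (tendsto_const_div_atTop_nhds_zero_nat (2 : ℝ)).const_sub 1
    simpa using h1.mul h2
  refine tendsto_of_tendsto_of_tendsto_of_le_of_le' hlow tendsto_const_nhds ?_ ?_
  · filter_upwards [hθ, eventually_ge_atTop 2] with n h1 h2
    exact ((H n).variance_sum_xi_mem_Icc h2 h1).1
  · filter_upwards [hθ, eventually_ge_atTop 2] with n h1 h2
    exact ((H n).variance_sum_xi_mem_Icc h2 h1).2

end Limit

end DilutedUStat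

end

theorem theorem1 {Ω : Type*} [MeasurableSpace Ω] (P : Measure Ω) [IsProbabilityMeasure P]
    (X : ℕ → ℕ → Ω → ℝ) (Z : ℕ → ℕ → ℕ → Ω → ℝ) (h : ℕ → ℝ → ℝ → ℝ) (p : ℕ → unitInterval)
    -- in each row, the `X n i`, `1 ≤ i ≤ n`, are i.i.d.
    (hX_meas : ∀ n, ∀ i ∈ Finset.Icc 1 n, Measurable (X n i))
    (hX_indep : ∀ n, iIndepFun (fun i : Finset.Icc 1 n => X n i) P)
    (hX_ident : ∀ n, ∀ i ∈ Finset.Icc 1 n, ∀ j ∈ Finset.Icc 1 n,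
      IdentDistrib (X n i) (X n j) P P)
    -- the kernels are Borel and symmetric
    (hh_meas : ∀ n, Measurable (Function.uncurry (h n)))
    (hh_symm : ∀ n x y, h n x y = h n y x)
    -- the edge variables are symmetric, and i.i.d. Bernoulli over the pairs `i < j`
    (hZ_meas : ∀ n, ∀ i ∈ Finset.Icc 1 n, ∀ j ∈ Finset.Icc 1 n, i ≠ j → Measurable (Z n i j))
    (hZ_symm : ∀ n, ∀ i ∈ Finset.Icc 1 n, ∀ j ∈ Finset.Icc 1 n, i ≠ j → Z n i j = Z n j i)
    (hZ_law : ∀ n, ∀ i ∈ Finset.Icc 1 n, ∀ j ∈ Finset.Icc 1 n, i ≠ j →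
      HasLaw (Z n i j) (bernoulliMeasure (1 : ℝ) 0 (p n)) P)
    (hZ_indep : ∀ n, iIndepFun
      (fun q : {q : ℕ × ℕ // 1 ≤ q.1 ∧ q.1 < q.2 ∧ q.2 ≤ n} => Z n q.1.1 q.1.2) P)
    -- the edge variables are independent of the `X n i`
    (hXZ_indep : ∀ n, IndepFun
      (fun ω (i : Finset.Icc 1 n) => X n i ω)
      (fun ω (q : {q : ℕ × ℕ // 1 ≤ q.1 ∧ q.1 < q.2 ∧ q.2 ≤ n}) => Z n q.1.1 q.1.2 ω) P)
    (hnp : Tendsto (fun n : ℕ => (n : ℝ) * (p n : ℝ)) atTop atTop)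
    -- centred, square integrable kernels
    (hh_mean : ∀ n, ∀ i ∈ Finset.Icc 1 n, ∀ j ∈ Finset.Icc 1 n, i ≠ j →
      ∫ ω, h n (X n i ω) (X n j ω) ∂P = 0)
    (hh_sq : ∀ n, ∀ i ∈ Finset.Icc 1 n, ∀ j ∈ Finset.Icc 1 n, i ≠ j →
      Integrable (fun ω => h n (X n i ω) (X n j ω) ^ 2) P)
    -- the conditional Lindeberg condition
    (hB1 : ∀ ε : ℝ, 0 < ε → TendstoInMeasure P
      (fun n => DilutedUStat.eta1 P n (p n) (h n) (X n) (Z n) ε) atTop (fun _ => 0))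
    -- the conditional variance condition
    (hB2 : TendstoInMeasure P
      (fun n => DilutedUStat.eta2 P n (p n) (h n) (X n) (Z n)) atTop (fun _ => 1)) :
    TendstoInDistribution
      (fun n ω => DilutedUStat.U n (h n) (X n) (Z n) ω /
        Real.sqrt (variance (DilutedUStat.U n (h n) (X n) (Z n)) P))
      atTop (id : ℝ → ℝ) (fun _ => P) (gaussianReal 0 1) := by
  have H : ∀ n, DilutedUStat.IsRow P n (p n) (h n) (X n) (Z n) := fun n =>
    ⟨hX_meas n, hX_indep n, hX_ident n, hh_meas n, hh_symm n, hZ_meas n, hZ_symm n, hZ_law n,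
      hZ_indep n, hXZ_indep n, hh_mean n, hh_sq n⟩
  have hθ := DilutedUStat.eventually_theta_ne_zero hB2
  have hS := DilutedUStat.tendstoInDistribution_sum_xi H hB1 hB2
  have hvar := DilutedUStat.tendsto_variance_sum_xi H hθ
  have hs : Tendsto (fun n => (Real.sqrt (variance (fun ω => ∑ i ∈ Finset.Icc 1 n,
      DilutedUStat.xi P n (p n) (h n) (X n) (Z n) i ω) P))⁻¹) atTop (𝓝 1) := by
    simpa using ((Real.continuous_sqrt.tendsto 1).comp hvar).inv₀ (by simp)
  have hslutsky := hS.continuous_comp_prodMk_of_tendstoInMeasure_const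
    (g := fun z : ℝ × ℝ => z.1 * z.2) (by fun_prop)
    (tendstoInMeasure_of_tendsto_ae (fun _ => aestronglyMeasurable_const)
      (ae_of_all P fun _ => hs)) (fun _ => aemeasurable_const)
  simp only [id, mul_one] at hslutsky
  -- for the finitely many rows with `θ = 0` or `n < 2` the two sequences may differ
  refine tendstoInDistribution_of_tendstoInMeasure_sub _ _ hslutsky ?_
    fun n => ((H n).measurable_U.div_const _).aemeasurable
  intro ε hε
  refine tendsto_const_nhds.congr' ?_
  filter_upwards [hθ, eventually_ge_atTop 2] with n h1 h2
  have h3 : ∀ ω, DilutedUStat.U n (h n) (X n) (Z n) ω /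
      Real.sqrt (variance (DilutedUStat.U n (h n) (X n) (Z n)) P) =
      (∑ i ∈ Finset.Icc 1 n, DilutedUStat.xi P n (p n) (h n) (X n) (Z n) i ω) *
        (Real.sqrt (variance (fun ω => ∑ i ∈ Finset.Icc 1 n,
          DilutedUStat.xi P n (p n) (h n) (X n) (Z n) i ω) P))⁻¹ :=
    (H n).U_div_sqrt_variance h2 h1
  simp [h3, hε.ne']
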